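/- Let $N\ge 3$, $2^*=\frac{2N}{N-2}$, and let $\mathcal D^{1,2}(\mathbb R^N)$ be the completion of $C_0^\infty(\mathbb R^N)$ (real-valued) with respect to the norm $\|u\|=\left(\int_{\mathbb R^N}|\nabla u|^2\,dx\right)^{1/2}$, regarded as a space of functions in $L^{2^*}(\mathbb R^N)$. Suppose that $(u_n)\subset\mathcal D^{1,2}(\mathbb R^N)$ is bounded. Then, after passing to a subsequence of $(u_n)$, still denoted by $(u_n)$, there are functions $\tilde u_i\in\mathcal D^{1,2}(\mathbb R^N)$, $i\ge 0$, and sequences $(y^i_n)_{n}\subset\mathbb R^N$, $i\ge 0$, such that $y^0_n=0$ for all $n$, $|y^i_n-y^j_n|\to\infty$ as $n\to\infty$ for $i\ne j$, and, with $$v^i_n:=u_n-\sum_{j=0}^i\tilde u_j(\cdot-y^j_n),$$ the following hold for every $i\ge 0$: (a) $u_n(\cdot+y^i_n)\rightharpoonup\tilde u_i$ weakly in $\mathcal D^{1,2}(\mathbb R^N)$ as $n\to\infty$; (b) both limits below exist in $\mathbb R$ and $$\lim_{n\to\infty}\int_{\mathbb R^N}|\nabla u_n|^2\,dx=\sum_{j=0}^i\int_{\mathbb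 R^N}|\nabla\tilde u_j|^2\,dx+\lim_{n\to\infty}\int_{\mathbb R^N}|\nabla v^i_n|^2\,dx;$$ (c) for every function $\Psi:\mathbb R\to\mathbb R$ of class $C^1$ with $\Psi(0)=0$ and $|\Psi'(s)|\le C|s|^{2^*-1}$ for all $s\in\mathbb R$ and some constant $C$, the function $\Psi(w)$ is integrable for every $w\in\mathcal D^{1,2}(\mathbb R^N)$, and $$\limsup_{n\to\infty}\int_{\mathbb R^N}\Psi(u_n)\,dx=\sum_{j=0}^i\int_{\mathbb R^N}\Psi(\tilde u_j)\,dx+\limsup_{n\to\infty}\int_{\mathbb R^N}\Psi(v^i_n)\,dx.$$ The subsequence, the $\tilde u_i$ and the $y^i_n$ do not depend on $\Psi$. Moreover, if $\Psi$ is as in (c) and in addition $$\lim_{s\to0}\frac{\Psi(s)}{|s|^{2^*}}=\lim_{|s|\to\infty}\frac{\Psi(s)}{|s|^{2^*}}=0,$$ then $$\lim_{i\to\infty}\left(\limsup_{n\to\infty}\int_{\mathbb R^N}\Psi(v^i_n)\,dx\right)=0.$$ -/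

import Mathlib

open MeasureTheory Filter Topology
open scoped ENNReal ContDiff

noncomputable section

namespace ProfileDecomposition

/-- The Euclidean space `ℝ^N`. -/
abbrev Eucl (N : ℕ) : Type := EuclideanSpace ℝ (Fin N)

/-- The critical Sobolev exponent `2^* = 2N / (N - 2)` (used for `N ≥ 3` only). -/
def critExp (N : ℕ) : ℝ := 2 * (N : ℝ) / ((N : ℝ) - 2)

theorem one_le_critExp (N : ℕ) (hN : 3 ≤ N) : 1 ≤ critExp N := by
  have h : (3 : ℝ) ≤ N := by exact_mod_cast hN
  unfold critExp
  rw [le_div_iff₀ (by linarith)]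
  linarith

instance (N : ℕ) [hN : Fact (3 ≤ N)] : Fact (1 ≤ ENNReal.ofReal (critExp N)) :=
  ⟨by simpa using one_le_critExp N hN.out⟩

/-- Pairs `(u, V)` of (classes of) functions `u ∈ L^{2^*}(ℝ^N)` and vector fields
`V ∈ L^2(ℝ^N; ℝ^N)`. -/
abbrev Pairs (N : ℕ) : Type :=
  Lp ℝ (ENNReal.ofReal (critExp N)) (volume : Measure (Eucl N)) ×
    Lp (Eucl N) 2 (volume : Measure (Eucl N))

/-- The subspace of all pairs `(φ, ∇φ)` with `φ ∈ C_0^∞(ℝ^N)`. -/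
def testPairs (N : ℕ) : Submodule ℝ (Pairs N) where
  carrier := {w | ∃ φ : Eucl N → ℝ, ContDiff ℝ ∞ φ ∧ HasCompactSupport φ ∧
    w.1 =ᵐ[volume] φ ∧ w.2 =ᵐ[volume] fun x => gradient φ x}
  zero_mem' := by
    refine ⟨0, contDiff_const, HasCompactSupport.zero, Lp.coeFn_zero _ _ _, ?_⟩
    filter_upwards [Lp.coeFn_zero (Eucl N) 2 (volume : Measure (Eucl N))] with x hx
    have h0 : gradient (0 : Eucl N → ℝ) x = 0 := gradient_const x (0 : ℝ)
    rw [h0]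
    exact hx
  add_mem' := by
    rintro a b ⟨φ, hφ, hφc, h1, h2⟩ ⟨ψ, hψ, hψc, h3, h4⟩
    refine ⟨φ + ψ, hφ.add hψ, hφc.add hψc, ?_, ?_⟩
    · exact (Lp.coeFn_add a.1 b.1).trans (h1.add h3)
    · refine (Lp.coeFn_add a.2 b.2).trans ((h2.add h4).trans (Eventually.of_forall fun x => ?_))
      have hx : fderiv ℝ (φ + ψ) x = fderiv ℝ φ x + fderiv ℝ ψ x :=
        fderiv_add (hφ.differentiable (by simp) x) (hψ.differentiable (by simp) x)
      simp [gradient, hx]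
  smul_mem' := by
    rintro c a ⟨φ, hφ, hφc, h1, h2⟩
    refine ⟨c • φ, contDiff_const.smul hφ, hφc.smul_left, ?_, ?_⟩
    · exact (Lp.coeFn_smul c a.1).trans (h1.const_smul c)
    · refine (Lp.coeFn_smul c a.2).trans
        ((h2.const_smul c).trans (Eventually.of_forall fun x => ?_))
      have hx : fderiv ℝ (c • φ) x = c • fderiv ℝ φ x :=
        fderiv_const_smul (hφ.differentiable (by simp) x) c
      simp [gradient, hx]

/-- The space `D^{1,2}(ℝ^N)`, `N ≥ 3`, realised as a space of functions: by the Sobolev inequality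
a sequence in `C_0^∞(ℝ^N)` that is Cauchy for the norm `(∫ |∇φ|²)^{1/2}` converges in `L^{2^*}`, so
the completion of `C_0^∞(ℝ^N)` for this norm is the closure of the pairs `(φ, ∇φ)` in
`L^{2^*} × L^2`. An element is a function together with its gradient. -/
def D12 (N : ℕ) [Fact (3 ≤ N)] : Submodule ℝ (Pairs N) := (testPairs N).topologicalClosure

/-- The function on `ℝ^N` underlying an element of `D^{1,2}(ℝ^N)`. -/
def D12.toFun {N : ℕ} [Fact (3 ≤ N)] (u : D12 N) : Eucl N → ℝ := u.1.1

/-- The gradient of an element of `D^{1,2}(ℝ^N)`. -/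
def D12.grad {N : ℕ} [Fact (3 ≤ N)] (u : D12 N) : Eucl N → Eucl N := u.1.2

/-- The Dirichlet energy `∫ |∇u|² dx`. -/
def D12.energy {N : ℕ} [Fact (3 ≤ N)] (u : D12 N) : ℝ := ∫ x, ‖D12.grad u x‖ ^ 2

/-- The norm `(∫ |∇u|² dx)^{1/2}` of `D^{1,2}(ℝ^N)`. -/
def D12.gradNorm {N : ℕ} [Fact (3 ≤ N)] (u : D12 N) : ℝ := Real.sqrt (D12.energy u)

/-- Weak convergence `u_n ⇀ v` in `D^{1,2}(ℝ^N)`: convergence under every linear functional that is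
bounded for the norm of `D^{1,2}(ℝ^N)`. -/
def D12.WeaklyTendsto {N : ℕ} [Fact (3 ≤ N)] (u : ℕ → D12 N) (v : D12 N) : Prop :=
  ∀ f : D12 N →ₗ[ℝ] ℝ, (∃ C : ℝ, ∀ w : D12 N, |f w| ≤ C * D12.gradNorm w) →
    Tendsto (fun n => f (u n)) atTop (𝓝 (f v))

theorem measurePreserving_add {N : ℕ} (y : Eucl N) :
    MeasurePreserving (fun x : Eucl N => x + y) volume volume :=
  measurePreserving_add_right volume y

/-- The translation `w ↦ w(· + y)` of both entries of a pair. -/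
def shiftPair {N : ℕ} (y : Eucl N) : Pairs N →ₗ[ℝ] Pairs N :=
  (Lp.compMeasurePreservingₗ ℝ (fun x : Eucl N => x + y) (measurePreserving_add y)).prodMap
    (Lp.compMeasurePreservingₗ ℝ (fun x : Eucl N => x + y) (measurePreserving_add y))

theorem shiftPair_mem_testPairs {N : ℕ} (y : Eucl N) {w : Pairs N} (hw : w ∈ testPairs N) :
    shiftPair y w ∈ testPairs N := by
  obtain ⟨φ, hφ, hφc, h1, h2⟩ := hw
  refine ⟨fun x => φ (x + y), hφ.comp (contDiff_id.add contDiff_const),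
    hφc.comp_homeomorph (Homeomorph.addRight y), ?_, ?_⟩
  · exact (Lp.coeFn_compMeasurePreserving w.1 (measurePreserving_add y)).trans
      ((measurePreserving_add y).quasiMeasurePreserving.ae_eq_comp h1)
  · refine (Lp.coeFn_compMeasurePreserving w.2 (measurePreserving_add y)).trans
      (((measurePreserving_add y).quasiMeasurePreserving.ae_eq_comp h2).trans
        (Eventually.of_forall fun x => ?_))
    simp [gradient, fderiv_comp_add_right]

theorem continuous_shiftPair {N : ℕ} [Fact (3 ≤ N)] (y : Eucl N) :
    Continuous (shiftPair y : Pairs N → Pairs N) :=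
  Continuous.prodMap
    (Lp.isometry_compMeasurePreserving (measurePreserving_add y)).continuous
    (Lp.isometry_compMeasurePreserving (measurePreserving_add y)).continuous

/-- The translate `u(· + y)` of `u ∈ D^{1,2}(ℝ^N)`. -/
def D12.shift {N : ℕ} [Fact (3 ≤ N)] (y : Eucl N) (u : D12 N) : D12 N :=
  ⟨shiftPair y u.1, map_mem_closure (continuous_shiftPair y) u.2
    fun _ hw => shiftPair_mem_testPairs y hw⟩

/-- The remainder `v^i = u - ∑_{j ≤ i} U_j(· - y^j)`. -/
def remainder {N : ℕ} [Fact (3 ≤ N)] (u : D12 N) (U : ℕ → D12 N) (y : ℕ → Eucl N) (i : ℕ) :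
    D12 N :=
  u - ∑ j ∈ Finset.range (i + 1), D12.shift (-(y j)) (U j)

/-- The integral `∫ Ψ(u) dx`. -/
def nonlinInt {N : ℕ} [Fact (3 ≤ N)] (Ψ : ℝ → ℝ) (u : D12 N) : ℝ := ∫ x, Ψ (D12.toFun u x)

/-- The condition `lim_{s → 0} Ψ(s)/|s|^{2^*} = lim_{|s| → ∞} Ψ(s)/|s|^{2^*} = 0`. -/
def SubcriticalAtZeroAndInfinity (N : ℕ) (Ψ : ℝ → ℝ) : Prop :=
  Tendsto (fun s : ℝ => Ψ s / |s| ^ critExp N) (𝓝[≠] 0) (𝓝 0) ∧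
    Tendsto (fun s : ℝ => Ψ s / |s| ^ critExp N) (atBot ⊔ atTop) (𝓝 0)

end ProfileDecomposition

end

open ProfileDecomposition

/-!
The argument rests on three ideas.

*Averages.* For `u ∈ D^{1,2}`, replacing `u` by its averages over balls of radius `r` costs at most
`r ‖∇u‖_2` in `L^2` (`lintegral_enorm_toFun_sub_average_sq_le`), although `u` itself need not lie in
`L^2`. By Chebyshev, `{|u| ≥ a}` is up to a set of measure `O(r²)` contained in the set where the
average is at least `a / 2` in absolute value (`measure_le_abs_toFun_le`). The average around a
point is a bounded functional on `D^{1,2}`, so this one estimate replaces both local compactness and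
the covering argument of Lions' lemma: weak convergence to zero gives convergence almost everywhere
along a subsequence (`WeakTo.exists_seq_tendsto_ae`), and functions with uniformly small averages
have small nonlinear integrals when the nonlinearity is negligible at zero and at infinity
(`HasGrowth.exists_abs_nonlinInt_le`).

*Splitting.* Seen from the `m`-th center, the remainder after the first `m` profiles converges
weakly to the `m`-th profile, since the other profiles escape to infinity
(`WeakTo.shift_partialRemainder`). Removing this limit splits off its energy by the Hilbert space
identity (`WeakTo.tendsto_energy_sub`) and its nonlinear integral by the Brezis–Lieb lemma
(`HasGrowth.tendsto_nonlinInt_sub`); induction on `m` gives the splittings of the theorem.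

*Choice of the centers.* Along a nonprincipal ultrafilter every bounded sequence in `D^{1,2}`
converges weakly, so every sequence of points has a profile and no subsequences are needed while
choosing. The next center is taken, among the sequences of points escaping from the previous
centers, with at least half of the largest possible gradient norm of the profile. If averages of a
remainder stay away from zero near some points, then these escape from the previous centers, because
the remainder vanishes weakly near each of them; hence the limit of the largest averages is at most
a multiple of the gradient norm of the next profile (`exists_tendsto_supAverage`). These norms tend
to zero, as the profiles have finite total energy. All this amounts to countably many limits along
the ultrafilter, which hold along a common subsequence (`exists_strictMono_tendsto`).
-/

noncomputable section

namespace ProfileDecomposition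

/-! ### Translations of `L^p` functions -/

section Translation

variable {N : ℕ} {F : Type*} [NormedAddCommGroup F] [NormedSpace ℝ F]
  {p : ℝ≥0∞} [Fact (1 ≤ p)]

/-- The translation `f ↦ f(· + y)` as a linear isometry of `L^p(ℝ^N; F)`. -/
def translate (F : Type*) [NormedAddCommGroup F] [NormedSpace ℝ F] (p : ℝ≥0∞) [Fact (1 ≤ p)]
    (y : Eucl N) :
    Lp F p (volume : Measure (Eucl N)) →ₗᵢ[ℝ] Lp F p (volume : Measure (Eucl N)) :=
  Lp.compMeasurePreservingₗᵢ ℝ (fun x : Eucl N => x + y) (measurePreserving_add y)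

theorem coeFn_translate (y : Eucl N) (f : Lp F p (volume : Measure (Eucl N))) :
    translate F p y f =ᵐ[volume] fun x => f (x + y) :=
  Lp.coeFn_compMeasurePreserving f (measurePreserving_add y)

theorem translate_translate (y z : Eucl N) (f : Lp F p (volume : Measure (Eucl N))) :
    translate F p y (translate F p z f) = translate F p (y + z) f := by
  refine Lp.ext ?_
  filter_upwards [coeFn_translate y (translate F p z f), coeFn_translate (y + z) f,
    (measurePreserving_add y).quasiMeasurePreserving.ae_eq_comp (coeFn_translate z f)]
    with x h1 h2 h3
  rw [h1, h2]
  simpa [add_assoc] using h3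

theorem translate_zero (f : Lp F p (volume : Measure (Eucl N))) :
    translate F p (0 : Eucl N) f = f := by
  refine Lp.ext ?_
  filter_upwards [coeFn_translate (0 : Eucl N) f] with x h1
  simpa using h1

theorem inner_translate_right (y : Eucl N) (f g : Lp (Eucl N) 2 (volume : Measure (Eucl N))) :
    inner ℝ f (translate (Eucl N) 2 y g) = inner ℝ (translate (Eucl N) 2 (-y) f) g := by
  have h := (translate (Eucl N) 2 y).inner_map_map (translate (Eucl N) 2 (-y) f) g
  rw [translate_translate, add_neg_cancel, translate_zero] at h
  exact h

theorem tendsto_translate {ι : Type*} {l : Filter ι} (hp : p ≠ ⊤) {z : ι → Eucl N} {z₀ : Eucl N}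
    (hz : Tendsto z l (𝓝 z₀)) (f : Lp F p (volume : Measure (Eucl N))) :
    Tendsto (fun i => translate F p (z i) f) l (𝓝 (translate F p z₀ f)) := by
  have hc : Continuous fun y : Eucl N => (⟨fun x => x + y, by fun_prop⟩ : C(Eucl N, Eucl N)) :=
    ContinuousMap.continuous_of_continuous_uncurry _ (by
      simp only [Function.uncurry_def]; exact (continuous_snd.add continuous_fst))
  exact (tendsto_const_nhds (x := f)).compMeasurePreservingLp ((hc.tendsto z₀).comp hz)
    (fun i => measurePreserving_add (z i)) (measurePreserving_add z₀) hp

/-- Translating to infinity sends every `L^2` field weakly to zero. For fields of compact support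
the translates are eventually orthogonal, and these fields are dense. -/
theorem tendsto_inner_translate_zero {ι : Type*} {l : Filter ι} {z : ι → Eucl N}
    (hz : Tendsto (fun i => ‖z i‖) l atTop) (f g : Lp (Eucl N) 2 (volume : Measure (Eucl N))) :
    Tendsto (fun i => inner ℝ g (translate (Eucl N) 2 (z i) f)) l (𝓝 0) := by
  have approx : ∀ (f : Lp (Eucl N) 2 (volume : Measure (Eucl N))) (ε : ℝ), 0 < ε →
      ∃ φ : Lp (Eucl N) 2 (volume : Measure (Eucl N)), ‖f - φ‖ ≤ ε ∧
        ∃ R : ℝ, ∀ᵐ x ∂(volume : Measure (Eucl N)), R < ‖x‖ → φ x = 0 := by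
    intro f ε hε
    obtain ⟨h, hc, hle, -, hmem⟩ := (Lp.memLp f).exists_hasCompactSupport_eLpNorm_sub_le
      ENNReal.ofNat_ne_top (ε := ENNReal.ofReal ε) (by simpa using hε)
    refine ⟨hmem.toLp h, ?_, ?_⟩
    · rw [Lp.norm_def]
      refine ENNReal.toReal_le_of_le_ofReal hε.le ?_
      refine le_trans (le_of_eq (eLpNorm_congr_ae ?_)) hle
      filter_upwards [Lp.coeFn_sub f (hmem.toLp h), hmem.coeFn_toLp] with x h1 h2
      rw [h1, Pi.sub_apply, Pi.sub_apply, h2]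
    · obtain ⟨R, hR⟩ := hc.isCompact.isBounded.exists_norm_le
      refine ⟨R, ?_⟩
      filter_upwards [hmem.coeFn_toLp] with x hx hRx
      rw [hx]
      by_contra hne
      exact absurd (hR x (subset_tsupport _ hne)) (not_le.2 hRx)
  rw [Metric.tendsto_nhds]
  intro ε hε
  obtain ⟨δ, hδ, hδε⟩ : ∃ δ > 0, δ * ‖f‖ + (‖g‖ + δ) * δ < ε := by
    have hc : ContinuousAt (fun δ : ℝ => δ * ‖f‖ + (‖g‖ + δ) * δ) 0 := by fun_prop
    have := hc.eventually_lt continuousAt_const (show _ < ε by simpa using hε)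
    obtain ⟨r, hr, h⟩ := Metric.eventually_nhds_iff.1 this
    exact ⟨r / 2, by positivity, h (by simp [abs_of_pos hr]; linarith)⟩
  obtain ⟨φ, hφ, R₁, hR₁⟩ := approx f δ hδ
  obtain ⟨ψ, hψ, R₂, hR₂⟩ := approx g δ hδ
  filter_upwards [hz.eventually_gt_atTop (R₁ + R₂)] with i hi
  have h0 : inner ℝ ψ (translate (Eucl N) 2 (z i) φ) = 0 := by
    rw [L2.inner_def]
    refine integral_eq_zero_of_ae ?_
    filter_upwards [coeFn_translate (z i) φ, hR₂,
      (measurePreserving_add (z i)).quasiMeasurePreserving.ae hR₁] with x h1 h2 h3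
    rw [h1]
    by_cases hx : R₂ < ‖x‖
    · simp [h2 hx]
    · have : R₁ < ‖x + z i‖ := by
        have := norm_sub_le (x + z i) x
        rw [add_sub_cancel_left] at this
        linarith
      simp [h3 this]
  have hd : inner ℝ g (translate (Eucl N) 2 (z i) f) =
      inner ℝ (g - ψ) (translate (Eucl N) 2 (z i) f) +
        inner ℝ ψ (translate (Eucl N) 2 (z i) (f - φ)) := by
    rw [map_sub, inner_sub_left, inner_sub_right, h0]; ring
  rw [Real.dist_eq, sub_zero, hd]
  have hψn : ‖ψ‖ ≤ ‖g‖ + δ := by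
    have := norm_sub_le g (g - ψ)
    rw [sub_sub_cancel] at this
    linarith
  calc _ ≤ |inner ℝ (g - ψ) (translate (Eucl N) 2 (z i) f)| +
        |inner ℝ ψ (translate (Eucl N) 2 (z i) (f - φ))| := abs_add_le _ _
    _ ≤ ‖g - ψ‖ * ‖f‖ + ‖ψ‖ * ‖f - φ‖ := by
        gcongr
        · simpa using abs_real_inner_le_norm (g - ψ) (translate (Eucl N) 2 (z i) f)
        · simpa only [LinearIsometry.norm_map] using
            abs_real_inner_le_norm ψ (translate (Eucl N) 2 (z i) (f - φ))
    _ ≤ δ * ‖f‖ + (‖g‖ + δ) * δ := by gcongr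
    _ < ε := hδε

theorem norm_gradient_eq {φ : Eucl N → ℝ} (x : Eucl N) : ‖gradient φ x‖ = ‖fderiv ℝ φ x‖ := by
  simp [gradient]

end Translation

/-! ### The Sobolev inequality and the gradient map on `D^{1,2}` -/

section Space

variable {N : ℕ} [hN : Fact (3 ≤ N)]

/-- The gradient as a linear map from `D^{1,2}` to `L^2`. -/
def gradMap (N : ℕ) [Fact (3 ≤ N)] : D12 N →ₗ[ℝ] Lp (Eucl N) 2 (volume : Measure (Eucl N)) :=
  LinearMap.snd ℝ _ _ ∘ₗ (D12 N).subtype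

theorem energy_eq_norm_sq (u : D12 N) : D12.energy u = ‖gradMap N u‖ ^ 2 := by
  rw [← real_inner_self_eq_norm_sq, L2.inner_def]
  simp only [real_inner_self_eq_norm_sq]
  rfl

theorem gradNorm_eq_norm (u : D12 N) : D12.gradNorm u = ‖gradMap N u‖ := by
  rw [D12.gradNorm, energy_eq_norm_sq, Real.sqrt_sq (norm_nonneg _)]

theorem critExp_gt_one (N : ℕ) [hN : Fact (3 ≤ N)] : 1 < critExp N := by
  have h : (3 : ℝ) ≤ N := by exact_mod_cast hN.out
  unfold critExp
  rw [lt_div_iff₀ (by linarith)]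
  linarith

/-- The Sobolev inequality on `D^{1,2}`, by density from the Gagliardo–Nirenberg–Sobolev
inequality for test functions. -/
theorem exists_sobolev (N : ℕ) [hN : Fact (3 ≤ N)] :
    ∃ C : ℝ, 0 ≤ C ∧ ∀ u : D12 N, ‖u.1.1‖ ≤ C * ‖gradMap N u‖ := by
  have h3 : (3 : ℝ) ≤ N := by exact_mod_cast hN.out
  have hp0 : 0 ≤ critExp N := (zero_le_one.trans (critExp_gt_one N).le)
  set C := SNormLESNormFDerivOfEqConst ℝ (volume : Measure (Eucl N)) (2 : NNReal) with hC
  refine ⟨C, C.2, fun u => ?_⟩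
  have key : (D12 N : Set (Pairs N)) ⊆ {w | ‖w.1‖ ≤ C * ‖w.2‖} := by
    refine closure_minimal ?_ (isClosed_le (by fun_prop) (by fun_prop))
    rintro w ⟨φ, hφ, hφc, h1, h2⟩
    have := eLpNorm_le_eLpNorm_fderiv_of_eq (volume : Measure (Eucl N)) (F := ℝ)
      (p := 2) (p' := (critExp N).toNNReal) (hφ.of_le (by simp)) hφc (by norm_num)
      (by simp; linarith [hN.out]) (by
        rw [Real.coe_toNNReal _ hp0]
        rw [critExp, finrank_euclideanSpace, Fintype.card_fin, NNReal.coe_inv, NNReal.coe_ofNat]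
        have : (N : ℝ) - 2 ≠ 0 := by linarith
        have : (N : ℝ) ≠ 0 := by linarith
        field_simp)
    have e1 : eLpNorm w.1 (ENNReal.ofReal (critExp N)) volume =
        eLpNorm φ (ENNReal.ofReal (critExp N)) volume := eLpNorm_congr_ae h1
    have e2 : eLpNorm w.2 2 volume = eLpNorm (fderiv ℝ φ) 2 volume := by
      rw [eLpNorm_congr_ae h2]
      exact eLpNorm_congr_norm_ae (Eventually.of_forall fun x => norm_gradient_eq x)
    show ‖w.1‖ ≤ C * ‖w.2‖
    rw [Lp.norm_def, Lp.norm_def, e1, e2]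
    have hfin : eLpNorm (fderiv ℝ φ) 2 volume ≠ ⊤ := by rw [← e2]; exact Lp.eLpNorm_ne_top _
    have h := ENNReal.toReal_mono (ENNReal.mul_ne_top ENNReal.coe_ne_top hfin) this
    rw [ENNReal.toReal_mul] at h
    exact h
  exact key u.2

/-- The constant of the Sobolev inequality `‖u‖_{2^*} ≤ C ‖∇u‖_2`. -/
def sobolevConst (N : ℕ) [Fact (3 ≤ N)] : ℝ := (exists_sobolev N).choose

theorem sobolevConst_nonneg (N : ℕ) [Fact (3 ≤ N)] : 0 ≤ sobolevConst N :=
  (exists_sobolev N).choose_spec.1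

theorem norm_fst_le (u : D12 N) : ‖u.1.1‖ ≤ sobolevConst N * ‖gradMap N u‖ :=
  (exists_sobolev N).choose_spec.2 u

theorem norm_le_gradMap (u : D12 N) : ‖u‖ ≤ max (sobolevConst N) 1 * ‖gradMap N u‖ := by
  have h : ‖u‖ = max ‖u.1.1‖ ‖gradMap N u‖ := rfl
  rw [h]
  refine max_le ((norm_fst_le u).trans ?_) ?_
  · gcongr; exact le_max_left _ _
  · exact le_mul_of_one_le_left (norm_nonneg _) (le_max_right _ _)

theorem gradMap_injective : Function.Injective (gradMap N) := by
  rw [injective_iff_map_eq_zero]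
  intro u hu
  have := norm_le_gradMap u
  rw [hu, norm_zero, mul_zero] at this
  exact norm_le_zero_iff.1 this

instance : CompleteSpace (D12 N) :=
  (Submodule.isClosed_topologicalClosure (testPairs N)).completeSpace_coe

theorem continuous_gradMap : Continuous (gradMap N) :=
  continuous_snd.comp continuous_subtype_val

theorem isClosed_range_gradMap : IsClosed (Set.range (gradMap N)) := by
  have ha : AntilipschitzWith (Real.toNNReal (max (sobolevConst N) 1)) (gradMap N) :=
    AddMonoidHomClass.antilipschitz_of_bound (gradMap N) fun u => by
      rw [Real.coe_toNNReal _ (zero_le_one.trans (le_max_right _ _))]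
      exact norm_le_gradMap u
  exact (ha.isComplete_range
    (uniformContinuous_addMonoidHom_of_continuous continuous_gradMap)).isClosed

theorem gradMap_shift (y : Eucl N) (u : D12 N) :
    gradMap N (D12.shift y u) = translate (Eucl N) 2 y (gradMap N u) := rfl

theorem toFun_shift (y : Eucl N) (u : D12 N) :
    D12.toFun (D12.shift y u) =ᵐ[volume] fun x => D12.toFun u (x + y) :=
  coeFn_translate y u.1.1

theorem shift_shift (y z : Eucl N) (u : D12 N) :
    D12.shift y (D12.shift z u) = D12.shift (y + z) u :=
  gradMap_injective (by simp only [gradMap_shift, translate_translate])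

theorem shift_zero (u : D12 N) : D12.shift 0 u = u :=
  gradMap_injective (by simp only [gradMap_shift, translate_zero])

/-- The translation `u ↦ u(· + y)` as a linear map on `D^{1,2}`. -/
def shiftMap (y : Eucl N) : D12 N →ₗ[ℝ] D12 N where
  toFun := D12.shift y
  map_add' u v := gradMap_injective (by simp only [gradMap_shift, map_add])
  map_smul' c u := gradMap_injective (by simp only [gradMap_shift, map_smul, RingHom.id_apply])

@[simp] theorem shiftMap_apply (y : Eucl N) (u : D12 N) : shiftMap y u = D12.shift y u := rfl

theorem shift_sub (y : Eucl N) (u v : D12 N) :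
    D12.shift y (u - v) = D12.shift y u - D12.shift y v := map_sub (shiftMap y) u v

theorem norm_gradMap_shift (y : Eucl N) (u : D12 N) :
    ‖gradMap N (D12.shift y u)‖ = ‖gradMap N u‖ := by
  rw [gradMap_shift, LinearIsometry.norm_map]

theorem energy_shift (y : Eucl N) (u : D12 N) : D12.energy (D12.shift y u) = D12.energy u := by
  rw [energy_eq_norm_sq, energy_eq_norm_sq, norm_gradMap_shift]

end Space

/-! ### Weak convergence in `D^{1,2}` -/

section Weak

variable {N : ℕ} [hN : Fact (3 ≤ N)] {ι : Type*} {l : Filter ι}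

/-- Functionals bounded for the gradient norm are represented by `L^2` fields: the gradient map
identifies `D^{1,2}` with a subspace of `L^2`, to which Hahn–Banach and Riesz apply. -/
theorem exists_inner_gradMap_eq (f : D12 N →ₗ[ℝ] ℝ) {C : ℝ}
    (hf : ∀ w, |f w| ≤ C * ‖gradMap N w‖) :
    ∃ g : Lp (Eucl N) 2 (volume : Measure (Eucl N)), ∀ w, f w = inner ℝ g (gradMap N w) := by
  let e := LinearEquiv.ofInjective (gradMap N) gradMap_injective
  let f' : LinearMap.range (gradMap N) →L[ℝ] ℝ := (f ∘ₗ e.symm.toLinearMap).mkContinuous C (by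
    intro x
    obtain ⟨w, rfl⟩ := e.surjective x
    simpa [e] using hf w)
  obtain ⟨F, hF, -⟩ := exists_extension_norm_eq _ f'
  refine ⟨(InnerProductSpace.toDual ℝ _).symm F, fun w => ?_⟩
  rw [InnerProductSpace.toDual_symm_apply]
  have := hF (e w)
  simp only [f', LinearMap.mkContinuous_apply, LinearMap.comp_apply, LinearEquiv.coe_coe,
    LinearEquiv.symm_apply_apply] at this
  exact this.symm

/-- Weak convergence in `D^{1,2}` along a filter, tested against `L^2` fields. -/
def WeakTo (l : Filter ι) (u : ι → D12 N) (v : D12 N) : Prop :=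
  ∀ g : Lp (Eucl N) 2 (volume : Measure (Eucl N)),
    Tendsto (fun i => inner ℝ g (gradMap N (u i))) l (𝓝 (inner ℝ g (gradMap N v)))

namespace WeakTo

theorem functional {u : ι → D12 N} {v : D12 N} (h : WeakTo l u v) (f : D12 N →ₗ[ℝ] ℝ) {C : ℝ}
    (hf : ∀ w, |f w| ≤ C * ‖gradMap N w‖) : Tendsto (fun i => f (u i)) l (𝓝 (f v)) := by
  obtain ⟨g, hg⟩ := exists_inner_gradMap_eq f hf
  simpa only [hg] using h g

theorem weaklyTendsto {u : ℕ → D12 N} {v : D12 N} (h : WeakTo atTop u v) :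
    D12.WeaklyTendsto u v := by
  rintro f ⟨C, hC⟩
  exact h.functional f fun w => by rw [← gradNorm_eq_norm]; exact hC w

theorem const (v : D12 N) : WeakTo l (fun _ => v) v := fun _ => tendsto_const_nhds

theorem sub {u u' : ι → D12 N} {v v' : D12 N} (h : WeakTo l u v) (h' : WeakTo l u' v') :
    WeakTo l (fun i => u i - u' i) (v - v') := fun g => by
  simpa only [map_sub, inner_sub_right] using (h g).sub (h' g)

theorem sum {κ : Type*} {s : Finset κ} {u : κ → ι → D12 N} {v : κ → D12 N}
    (h : ∀ j ∈ s, WeakTo l (u j) (v j)) :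
    WeakTo l (fun i => ∑ j ∈ s, u j i) (∑ j ∈ s, v j) := fun g => by
  simpa only [map_sum, inner_sum] using tendsto_finsetSum s fun j hj => h j hj g

theorem shift {u : ι → D12 N} {v : D12 N} (h : WeakTo l u v) (y : Eucl N) :
    WeakTo l (fun i => D12.shift y (u i)) (D12.shift y v) := fun g => by
  simpa only [gradMap_shift, inner_translate_right] using h (translate (Eucl N) 2 (-y) g)

theorem unique [NeBot l] {u : ι → D12 N} {v v' : D12 N} (h : WeakTo l u v) (h' : WeakTo l u v') :
    v = v' :=
  gradMap_injective (ext_inner_left ℝ fun g => tendsto_nhds_unique (h g) (h' g))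

/-- Profiles escaping to infinity vanish weakly. -/
theorem shift_escaping {z : ι → Eucl N} (hz : Tendsto (fun i => ‖z i‖) l atTop) (v : D12 N) :
    WeakTo l (fun i => D12.shift (z i) v) 0 := fun g => by
  simpa only [gradMap_shift, map_zero, inner_zero_right] using
    tendsto_inner_translate_zero hz (gradMap N v) g

/-- Convergent translations preserve weak convergence to zero: the translations may be moved to the
test field, where they converge strongly. -/
theorem shift_convergent {u : ι → D12 N} {M : ℝ} (hM : ∀ i, ‖gradMap N (u i)‖ ≤ M)
    (h : WeakTo l u 0) {z : ι → Eucl N} {z₀ : Eucl N} (hz : Tendsto z l (𝓝 z₀)) :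
    WeakTo l (fun i => D12.shift (z i) (u i)) 0 := fun g => by
  have h1 := h (translate (Eucl N) 2 (-z₀) g)
  have h2 := tendsto_translate ENNReal.ofNat_ne_top hz.neg g
  rw [tendsto_iff_norm_sub_tendsto_zero] at h2
  have h3 : Tendsto (fun i => inner ℝ (translate (Eucl N) 2 (-z i) g -
      translate (Eucl N) 2 (-z₀) g) (gradMap N (u i))) l (𝓝 0) := by
    refine squeeze_zero_norm (fun i => ?_) (by simpa using h2.mul_const M)
    exact (norm_inner_le_norm _ _).trans (mul_le_mul_of_nonneg_left (hM i) (norm_nonneg _))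
  have h4 := h3.add h1
  simp only [map_zero, inner_zero_right, add_zero] at h4 ⊢
  refine h4.congr fun i => ?_
  rw [gradMap_shift, inner_translate_right, inner_sub_left, sub_add_cancel]

theorem norm_le [NeBot l] {u : ι → D12 N} {v : D12 N} (h : WeakTo l u v) {M : ℝ}
    (hM : ∀ i, ‖gradMap N (u i)‖ ≤ M) : ‖gradMap N v‖ ≤ M := by
  have h1 : ‖gradMap N v‖ * ‖gradMap N v‖ ≤ ‖gradMap N v‖ * M := by
    rw [← real_inner_self_eq_norm_mul_norm]
    exact le_of_tendsto (h _) (Eventually.of_forall fun i => (real_inner_le_norm _ _).trans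
      (mul_le_mul_of_nonneg_left (hM i) (norm_nonneg _)))
  rcases (norm_nonneg (gradMap N v)).eq_or_lt with h0 | h0
  · rw [← h0]
    obtain ⟨i⟩ : Nonempty ι := nonempty_of_neBot l
    exact (norm_nonneg _).trans (hM i)
  · exact le_of_mul_le_mul_left h1 h0

/-- Weak convergence splits the Dirichlet energy. -/
theorem tendsto_energy_sub {u : ι → D12 N} {v : D12 N} (h : WeakTo l u v) :
    Tendsto (fun i => D12.energy (u i) - D12.energy (u i - v)) l (𝓝 (D12.energy v)) := by
  have h1 := ((h (gradMap N v)).const_mul 2).sub_const (‖gradMap N v‖ ^ 2)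
  rw [real_inner_self_eq_norm_sq, two_mul, add_sub_cancel_right, ← energy_eq_norm_sq] at h1
  refine h1.congr fun i => ?_
  rw [energy_eq_norm_sq, energy_eq_norm_sq, energy_eq_norm_sq, map_sub, norm_sub_sq_real,
    real_inner_comm]
  ring

/-- For bounded families it is enough to test weak convergence on a dense set of fields. -/
theorem of_denseRange {κ : Type*} {d : κ → Lp (Eucl N) 2 (volume : Measure (Eucl N))}
    (hd : DenseRange d) {u : ι → D12 N} {v : D12 N} {M : ℝ} (hM : ∀ i, ‖gradMap N (u i)‖ ≤ M)
    (h : ∀ k, Tendsto (fun i => inner ℝ (d k) (gradMap N (u i))) l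
      (𝓝 (inner ℝ (d k) (gradMap N v)))) : WeakTo l u v := by
  intro g
  rw [Metric.tendsto_nhds]
  intro ε hε
  set K := |M| + ‖gradMap N v‖ + 1
  have hK : 0 < K := by positivity
  obtain ⟨k, hk⟩ := hd.exists_dist_lt g (show 0 < ε / 2 / K by positivity)
  filter_upwards [Metric.tendsto_nhds.1 (h k) (ε / 2) (by positivity)] with i hi
  have e : inner ℝ g (gradMap N (u i)) - inner ℝ g (gradMap N v) =
      inner ℝ (g - d k) (gradMap N (u i) - gradMap N v) +
        (inner ℝ (d k) (gradMap N (u i)) - inner ℝ (d k) (gradMap N v)) := by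
    simp only [inner_sub_left, inner_sub_right]; ring
  rw [Real.dist_eq] at hi ⊢
  rw [e]
  have h1 : |inner ℝ (g - d k) (gradMap N (u i) - gradMap N v)| ≤ ε / 2 / K * K := by
    refine (abs_real_inner_le_norm _ _).trans ?_
    gcongr
    · rw [← dist_eq_norm]; exact hk.le
    · refine (norm_sub_le _ _).trans ?_
      have := (hM i).trans (le_abs_self M)
      simp only [K]; linarith
  rw [div_mul_cancel₀ _ hK.ne'] at h1
  linarith [abs_add_le (inner ℝ (g - d k) (gradMap N (u i) - gradMap N v))
    (inner ℝ (d k) (gradMap N (u i)) - inner ℝ (d k) (gradMap N v))]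

end WeakTo

theorem exists_tendsto_ultrafilter_of_abs_le (U : Ultrafilter ι) {a : ι → ℝ} {M : ℝ}
    (h : ∀ i, |a i| ≤ M) : ∃ b, Tendsto a U (𝓝 b) := by
  obtain ⟨b, -, hb⟩ := (isCompact_Icc (a := -M) (b := M)).ultrafilter_le_nhds (U.map a) (by
    rw [le_principal_iff]
    exact mem_map.2 (Eventually.of_forall fun i => abs_le.1 (h i)))
  exact ⟨b, hb⟩

/-- Bounded families converge weakly along every ultrafilter: the limits of the inner products form
a bounded functional, which Riesz represents, and the closed range of the gradient map is weakly
closed. -/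
theorem exists_weakTo_ultrafilter (U : Ultrafilter ι) {u : ι → D12 N} {M : ℝ}
    (hM : ∀ i, ‖gradMap N (u i)‖ ≤ M) : ∃ v, WeakTo (U : Filter ι) u v := by
  have hb : ∀ g : Lp (Eucl N) 2 (volume : Measure (Eucl N)), ∀ i,
      |inner ℝ g (gradMap N (u i))| ≤ M * ‖g‖ := fun g i => by
    rw [mul_comm]
    exact (abs_real_inner_le_norm _ _).trans
      (mul_le_mul_of_nonneg_left (hM i) (norm_nonneg _))
  choose b hb' using fun g => exists_tendsto_ultrafilter_of_abs_le U (hb g)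
  let f : Lp (Eucl N) 2 (volume : Measure (Eucl N)) →ₗ[ℝ] ℝ :=
    { toFun := b
      map_add' := fun g g' => tendsto_nhds_unique (hb' (g + g'))
        (by simpa only [inner_add_left] using (hb' g).add (hb' g'))
      map_smul' := fun c g => tendsto_nhds_unique (hb' (c • g))
        (by simpa only [real_inner_smul_left, RingHom.id_apply, smul_eq_mul] using
          (hb' g).const_mul c) }
  let f' := f.mkContinuous M fun g =>
    le_of_tendsto (hb' g).norm (Eventually.of_forall fun i => hb g i)
  set x := (InnerProductSpace.toDual ℝ _).symm f' with hx
  have hxg : ∀ g, inner ℝ g x = b g := fun g => by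
    rw [real_inner_comm, hx, InnerProductSpace.toDual_symm_apply]; rfl
  set R := LinearMap.range (gradMap N)
  have : CompleteSpace R := (isClosed_range_gradMap (N := N)).completeSpace_coe
  have hxR : x ∈ R := by
    rw [← Submodule.orthogonal_orthogonal R, Submodule.mem_orthogonal]
    intro g hg
    rw [hxg]
    refine tendsto_nhds_unique (hb' g) (tendsto_const_nhds.congr fun i => ?_)
    exact (Submodule.inner_left_of_mem_orthogonal (LinearMap.mem_range_self _ (u i)) hg).symm
  obtain ⟨v, hv⟩ := hxR
  exact ⟨v, fun g => by rw [hv, hxg]; exact hb' g⟩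

end Weak

/-! ### Averages over small balls -/

theorem sq_lintegral_le_lintegral_sq {α : Type*} [MeasurableSpace α] {μ : Measure α}
    [IsProbabilityMeasure μ] {f : α → ℝ≥0∞} (hf : AEMeasurable f μ) :
    (∫⁻ a, f a ∂μ) ^ 2 ≤ ∫⁻ a, f a ^ 2 ∂μ := by
  have h := ENNReal.lintegral_mul_le_Lp_mul_Lq μ Real.HolderConjugate.two_two hf
    (g := fun _ => 1) aemeasurable_const
  simp only [Pi.mul_apply, mul_one, lintegral_const, measure_univ,
    ENNReal.rpow_ofNat, one_pow, ENNReal.one_rpow] at h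
  calc _ ≤ ((∫⁻ a, f a ^ 2 ∂μ) ^ (1 / 2 : ℝ)) ^ 2 := by gcongr
    _ = _ := by
      rw [← ENNReal.rpow_natCast, ← ENNReal.rpow_mul]; norm_num

section Average

variable {N : ℕ}

/-- The uniform probability measure on the ball of radius `ε` around the origin. -/
def ballMeasure (N : ℕ) (ε : ℝ) : Measure (Eucl N) :=
  ProbabilityTheory.cond volume (Metric.ball 0 ε)

theorem isProbabilityMeasure_ballMeasure {ε : ℝ} (hε : 0 < ε) :
    IsProbabilityMeasure (ballMeasure N ε) :=
  ProbabilityTheory.cond_isProbabilityMeasure_of_finite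
    (Metric.measure_ball_pos volume 0 hε).ne' measure_ball_lt_top.ne

theorem ballMeasure_absolutelyContinuous (ε : ℝ) : ballMeasure N ε ≪ volume :=
  ProbabilityTheory.cond_absolutelyContinuous

theorem memLp_ballMeasure {p : ℝ≥0∞} {f : Eucl N → ℝ} (hf : MemLp f p volume) {ε : ℝ}
    (hε : 0 < ε) : MemLp f p (ballMeasure N ε) :=
  (hf.restrict _).smul_measure (ENNReal.inv_ne_top.2 (Metric.measure_ball_pos volume 0 hε).ne')

theorem enorm_sub_sq_le {φ : Eucl N → ℝ} (hφ : ContDiff ℝ 1 φ) (x h : Eucl N) :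
    ‖φ x - φ (h + x)‖ₑ ^ 2 ≤
      ‖h‖ₑ ^ 2 * ∫⁻ t in Set.Ioc (0 : ℝ) 1, ‖fderiv ℝ φ (x + t • h)‖ₑ ^ 2 := by
  have hd : ∀ t : ℝ, HasDerivAt (fun t : ℝ => φ (x + t • h)) (fderiv ℝ φ (x + t • h) h) t := by
    intro t
    have h1 : HasDerivAt (fun t : ℝ => x + t • h) h t := by
      simpa using ((hasDerivAt_id t).smul_const h).const_add x
    exact ((hφ.differentiable one_ne_zero) _).hasFDerivAt.comp_hasDerivAt t h1
  have hD : Continuous (fderiv ℝ φ) := hφ.continuous_fderiv one_ne_zero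
  have hc : Continuous fun t : ℝ => fderiv ℝ φ (x + t • h) h := by fun_prop
  have key := intervalIntegral.integral_eq_sub_of_hasDerivAt (a := 0) (b := 1)
    (fun t _ => hd t) (hc.intervalIntegrable 0 1)
  rw [intervalIntegral.integral_of_le zero_le_one] at key
  simp only [one_smul, zero_smul, add_zero] at key
  rw [add_comm h x, ← enorm_neg, neg_sub, ← key]
  have : IsProbabilityMeasure (volume.restrict (Set.Ioc (0 : ℝ) 1)) := ⟨by simp⟩
  have hm : Measurable fun t : ℝ => ‖fderiv ℝ φ (x + t • h)‖ₑ :=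
    (by fun_prop : Continuous fun t : ℝ => ‖fderiv ℝ φ (x + t • h)‖ₑ).measurable
  calc _ ≤ (∫⁻ t in Set.Ioc (0 : ℝ) 1, ‖fderiv ℝ φ (x + t • h)‖ₑ * ‖h‖ₑ) ^ 2 := by
        gcongr
        refine (enorm_integral_le_lintegral_enorm _).trans (lintegral_mono fun t => ?_)
        exact ContinuousLinearMap.le_opENorm _ _
    _ = ‖h‖ₑ ^ 2 * (∫⁻ t in Set.Ioc (0 : ℝ) 1, ‖fderiv ℝ φ (x + t • h)‖ₑ) ^ 2 := by
        rw [lintegral_mul_const _ hm, mul_pow, mul_comm]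
    _ ≤ _ := by
        gcongr
        exact sq_lintegral_le_lintegral_sq hm.aemeasurable

/-- A translation by `h` moves a smooth function by at most `|h| ‖∇φ‖_2` in `L^2`. -/
theorem lintegral_enorm_sub_translate_sq_le {φ : Eucl N → ℝ} (hφ : ContDiff ℝ 1 φ) (h : Eucl N) :
    ∫⁻ x, ‖φ x - φ (h + x)‖ₑ ^ 2 ≤ ‖h‖ₑ ^ 2 * ∫⁻ x, ‖fderiv ℝ φ x‖ₑ ^ 2 := by
  have hD : Continuous (fderiv ℝ φ) := hφ.continuous_fderiv one_ne_zero
  have hm : Measurable fun q : Eucl N × ℝ => ‖fderiv ℝ φ (q.1 + q.2 • h)‖ₑ ^ 2 :=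
    Measurable.pow_const
      (by fun_prop : Continuous fun q : Eucl N × ℝ => ‖fderiv ℝ φ (q.1 + q.2 • h)‖ₑ).measurable _
  calc _ ≤ ∫⁻ x, ‖h‖ₑ ^ 2 * ∫⁻ t in Set.Ioc (0 : ℝ) 1, ‖fderiv ℝ φ (x + t • h)‖ₑ ^ 2 :=
        lintegral_mono fun x => enorm_sub_sq_le hφ x h
    _ = ‖h‖ₑ ^ 2 * ∫⁻ x, ∫⁻ t in Set.Ioc (0 : ℝ) 1, ‖fderiv ℝ φ (x + t • h)‖ₑ ^ 2 :=
        lintegral_const_mul _ hm.lintegral_prod_right'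
    _ = ‖h‖ₑ ^ 2 * ∫⁻ t in Set.Ioc (0 : ℝ) 1, ∫⁻ x, ‖fderiv ℝ φ (x + t • h)‖ₑ ^ 2 := by
        rw [lintegral_lintegral_swap hm.aemeasurable]
    _ = ‖h‖ₑ ^ 2 * ∫⁻ x, ‖fderiv ℝ φ x‖ₑ ^ 2 := by
        congr 1
        simp_rw [lintegral_add_right_eq_self (fun x => ‖fderiv ℝ φ x‖ₑ ^ 2)]
        simp

theorem lintegral_enorm_sub_average_sq_le {φ : Eucl N → ℝ} (hφ : ContDiff ℝ 1 φ)
    (hφc : HasCompactSupport φ) {ε : ℝ} (hε : 0 < ε) :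
    ∫⁻ x, ‖φ x - ∫ h, φ (h + x) ∂ballMeasure N ε‖ₑ ^ 2 ≤
      ENNReal.ofReal ε ^ 2 * ∫⁻ x, ‖fderiv ℝ φ x‖ₑ ^ 2 := by
  have hpr := isProbabilityMeasure_ballMeasure (N := N) hε
  have hc := hφ.continuous
  obtain ⟨B, hB⟩ := hφc.exists_bound_of_continuous hc
  have hint : ∀ x, Integrable (fun h => φ (h + x)) (ballMeasure N ε) := fun x =>
    Integrable.of_bound (by fun_prop : Continuous fun h => φ (h + x)).aestronglyMeasurable B
      (Eventually.of_forall fun h => hB _)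
  have hm : Measurable fun q : Eucl N × Eucl N => ‖φ q.1 - φ (q.2 + q.1)‖ₑ ^ 2 :=
    Measurable.pow_const
      (by fun_prop : Continuous fun q : Eucl N × Eucl N => ‖φ q.1 - φ (q.2 + q.1)‖ₑ).measurable _
  calc _ ≤ ∫⁻ x, ∫⁻ h, ‖φ x - φ (h + x)‖ₑ ^ 2 ∂ballMeasure N ε := by
        refine lintegral_mono fun x => ?_
        have e : φ x - ∫ h, φ (h + x) ∂ballMeasure N ε =
            ∫ h, (φ x - φ (h + x)) ∂ballMeasure N ε := by
          rw [integral_sub (integrable_const _) (hint x)]; simp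
        rw [e]
        refine le_trans ?_ (sq_lintegral_le_lintegral_sq ?_)
        · gcongr
          exact enorm_integral_le_lintegral_enorm _
        · exact (by fun_prop : Continuous fun h => ‖φ x - φ (h + x)‖ₑ).measurable.aemeasurable
    _ = ∫⁻ h, ∫⁻ x, ‖φ x - φ (h + x)‖ₑ ^ 2 ∂volume ∂ballMeasure N ε :=
        lintegral_lintegral_swap hm.aemeasurable
    _ ≤ ∫⁻ h, ENNReal.ofReal ε ^ 2 * ∫⁻ x, ‖fderiv ℝ φ x‖ₑ ^ 2 ∂volume ∂ballMeasure N ε := by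
        refine lintegral_mono_ae ?_
        filter_upwards [ProbabilityTheory.ae_cond_mem Metric.isOpen_ball.measurableSet] with h hh
        refine (lintegral_enorm_sub_translate_sq_le hφ h).trans ?_
        gcongr
        rw [← ofReal_norm]
        exact ENNReal.ofReal_le_ofReal (mem_ball_zero_iff.1 hh).le
    _ = _ := by simp

end Average

section Average

variable {N : ℕ} [hN : Fact (3 ≤ N)]

theorem integrable_ballMeasure (u : D12 N) {ε : ℝ} (hε : 0 < ε) :
    Integrable (D12.toFun u) (ballMeasure N ε) :=
  have := isProbabilityMeasure_ballMeasure (N := N) hε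
  (memLp_ballMeasure (Lp.memLp u.1.1) hε).integrable Fact.out

/-- The average of `u ∈ D^{1,2}` over the ball of radius `1 / (k + 1)` around the origin. -/
def average (k : ℕ) : D12 N →ₗ[ℝ] ℝ where
  toFun u := ∫ h, D12.toFun u h ∂ballMeasure N (1 / (k + 1))
  map_add' u v := by
    have hε : (0 : ℝ) < 1 / (k + 1) := by positivity
    rw [← integral_add (integrable_ballMeasure u hε) (integrable_ballMeasure v hε)]
    exact integral_congr_ae
      ((ballMeasure_absolutelyContinuous _).ae_le (Lp.coeFn_add u.1.1 v.1.1))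
  map_smul' c u := by
    rw [RingHom.id_apply, smul_eq_mul, ← integral_const_mul]
    exact integral_congr_ae
      ((ballMeasure_absolutelyContinuous _).ae_le (Lp.coeFn_smul c u.1.1))

/-- Averages are bounded functionals on `D^{1,2}`, by the Sobolev and Hölder inequalities. -/
theorem exists_average_le (N : ℕ) [Fact (3 ≤ N)] (k : ℕ) :
    ∃ C : ℝ, 0 ≤ C ∧ ∀ u : D12 N, |average k u| ≤ C * ‖gradMap N u‖ := by
  have hε : (0 : ℝ) < 1 / (k + 1) := by positivity
  have hpr := isProbabilityMeasure_ballMeasure (N := N) hε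
  set p := ENNReal.ofReal (critExp N) with hp
  have hc : (volume (Metric.ball (0 : Eucl N) (1 / (k + 1))))⁻¹ ≠ ⊤ :=
    ENNReal.inv_ne_top.2 (Metric.measure_ball_pos volume 0 hε).ne'
  set K := (volume (Metric.ball (0 : Eucl N) (1 / (k + 1))))⁻¹ ^ (1 / p).toReal with hK
  have hKt : K ≠ ⊤ := ENNReal.rpow_ne_top_of_nonneg ENNReal.toReal_nonneg hc
  refine ⟨K.toReal * sobolevConst N, mul_nonneg ENNReal.toReal_nonneg (sobolevConst_nonneg N),
    fun u => ?_⟩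
  rw [mul_assoc]
  refine le_trans ?_ (mul_le_mul_of_nonneg_left (norm_fst_le u) ENNReal.toReal_nonneg)
  have h1 : ‖average k u‖ₑ ≤ K * eLpNorm u.1.1 p volume := by
    calc ‖average k u‖ₑ ≤ ∫⁻ h, ‖D12.toFun u h‖ₑ ∂ballMeasure N (1 / (k + 1)) :=
          enorm_integral_le_lintegral_enorm _
      _ = eLpNorm (D12.toFun u) 1 (ballMeasure N (1 / (k + 1))) :=
          eLpNorm_one_eq_lintegral_enorm.symm
      _ ≤ eLpNorm (D12.toFun u) p (ballMeasure N (1 / (k + 1))) :=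
          eLpNorm_le_eLpNorm_of_exponent_le Fact.out
            (integrable_ballMeasure u hε).aestronglyMeasurable
      _ ≤ _ := by
          rw [ballMeasure, ProbabilityTheory.cond, eLpNorm_smul_measure_of_ne_top
            ENNReal.ofReal_ne_top, smul_eq_mul]
          gcongr
          exact eLpNorm_mono_measure _ Measure.restrict_le_self
  have h2 := ENNReal.toReal_mono (ENNReal.mul_ne_top hKt (Lp.eLpNorm_ne_top u.1.1)) h1
  rwa [toReal_enorm, ENNReal.toReal_mul, ← Lp.norm_def] at h2

theorem average_shift (k : ℕ) (x : Eucl N) (u : D12 N) :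
    average k (D12.shift x u) = ∫ h, D12.toFun u (h + x) ∂ballMeasure N (1 / (k + 1)) :=
  integral_congr_ae ((ballMeasure_absolutelyContinuous _).ae_le (toFun_shift x u))

theorem stronglyMeasurable_toFun (u : D12 N) : StronglyMeasurable (D12.toFun u) :=
  Lp.stronglyMeasurable u.1.1

theorem stronglyMeasurable_average_shift (k : ℕ) (u : D12 N) :
    StronglyMeasurable fun x => average k (D12.shift x u) := by
  have hpr := isProbabilityMeasure_ballMeasure (N := N) (ε := 1 / (k + 1)) (by positivity)
  simp_rw [average_shift]
  exact StronglyMeasurable.integral_prod_right (f := fun x h => D12.toFun u (h + x))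
    ((stronglyMeasurable_toFun u).comp_measurable (measurable_snd.add measurable_fst))

theorem lintegral_enorm_grad_sq (u : D12 N) :
    ∫⁻ x, ‖D12.grad u x‖ₑ ^ 2 = ENNReal.ofReal (D12.energy u) := by
  have h := eLpNorm_nnreal_pow_eq_lintegral (f := D12.grad u) (p := 2) (μ := volume) two_ne_zero
  rw [energy_eq_norm_sq, ENNReal.ofReal_pow (norm_nonneg _), ofReal_norm, Lp.enorm_def]
  simp only [NNReal.coe_ofNat, ENNReal.rpow_ofNat] at h
  exact h.symm

theorem lintegral_enorm_sub_average_sq_le_of_testPairs (k : ℕ) (u : D12 N)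
    (hu : u.1 ∈ testPairs N) :
    ∫⁻ x, ‖D12.toFun u x - average k (D12.shift x u)‖ₑ ^ 2 ≤
      ENNReal.ofReal (1 / (k + 1)) ^ 2 * ENNReal.ofReal (D12.energy u) := by
  obtain ⟨φ, hφ, hφc, h1, h2⟩ := hu
  have h := lintegral_enorm_sub_average_sq_le (hφ.of_le (by simp)) hφc
    (show (0 : ℝ) < 1 / (k + 1) by positivity)
  have e1 : ∀ x, average k (D12.shift x u) = ∫ h, φ (h + x) ∂ballMeasure N (1 / (k + 1)) := by
    intro x
    rw [average_shift]
    exact integral_congr_ae ((ballMeasure_absolutelyContinuous _).ae_le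
      ((measurePreserving_add x).quasiMeasurePreserving.ae_eq_comp h1))
  rw [← lintegral_enorm_grad_sq]
  refine le_trans (le_of_eq ?_) (h.trans (le_of_eq ?_))
  · refine lintegral_congr_ae ?_
    filter_upwards [h1] with x hx
    rw [e1, D12.toFun, hx]
  · congr 1
    refine lintegral_congr_ae ?_
    filter_upwards [h2] with x hx
    rw [D12.grad, hx, ← ofReal_norm, ← ofReal_norm, norm_gradient_eq]

/-- Replacing `u` by its averages over balls of radius `r` costs at most `r ‖∇u‖_2` in `L^2`,
although neither function needs to lie in `L^2`. -/
theorem lintegral_enorm_toFun_sub_average_sq_le (k : ℕ) (u : D12 N) :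
    ∫⁻ x, ‖D12.toFun u x - average k (D12.shift x u)‖ₑ ^ 2 ≤
      ENNReal.ofReal (1 / (k + 1)) ^ 2 * ENNReal.ofReal (D12.energy u) := by
  obtain ⟨w, hw, hlim⟩ := mem_closure_iff_seq_limit.1 (show u.1 ∈ closure (testPairs N : Set _)
    from u.2)
  let W : ℕ → D12 N := fun n => ⟨w n, subset_closure (hw n)⟩
  have hW : Tendsto W atTop (𝓝 u) := tendsto_subtype_rng.2 hlim
  have hfst : Tendsto (fun n => (w n).1) atTop (𝓝 u.1.1) := (continuous_fst.tendsto _).comp hlim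
  obtain ⟨σ, hσ, hae⟩ := (tendstoInMeasure_of_tendsto_Lp hfst).exists_seq_tendsto_ae
  obtain ⟨C, hC, hav⟩ := exists_average_le N k
  have hgr : Tendsto (fun n => gradMap N (W (σ n))) atTop (𝓝 (gradMap N u)) :=
    (continuous_gradMap.tendsto u).comp (hW.comp hσ.tendsto_atTop)
  have hE : Tendsto (fun n => D12.energy (W (σ n))) atTop (𝓝 (D12.energy u)) := by
    simp only [energy_eq_norm_sq]
    exact hgr.norm.pow 2
  have hA : ∀ x, Tendsto (fun n => average k (D12.shift x (W (σ n)))) atTop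
      (𝓝 (average k (D12.shift x u))) := by
    intro x
    rw [tendsto_iff_norm_sub_tendsto_zero] at hgr ⊢
    refine squeeze_zero (fun _ => norm_nonneg _) (fun n => ?_) (by simpa using hgr.const_mul C)
    rw [← map_sub, ← shift_sub, ← map_sub, ← norm_gradMap_shift x]
    exact hav _
  -- Fatou's lemma along a sequence of test functions converging almost everywhere
  calc _ ≤ ∫⁻ x, liminf (fun n =>
        ‖D12.toFun (W (σ n)) x - average k (D12.shift x (W (σ n)))‖ₑ ^ 2) atTop := by
        refine lintegral_mono_ae ?_
        filter_upwards [hae] with x hx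
        exact le_of_eq ((ENNReal.Tendsto.pow (hx.sub (hA x)).enorm).liminf_eq).symm
    _ ≤ liminf (fun n => ∫⁻ x,
        ‖D12.toFun (W (σ n)) x - average k (D12.shift x (W (σ n)))‖ₑ ^ 2) atTop :=
        lintegral_liminf_le' fun n => (((stronglyMeasurable_toFun _).sub
          (stronglyMeasurable_average_shift k _)).enorm.pow_const 2).aemeasurable
    _ ≤ liminf (fun n => ENNReal.ofReal (1 / (k + 1)) ^ 2 *
        ENNReal.ofReal (D12.energy (W (σ n)))) atTop :=
        liminf_le_liminf (Eventually.of_forall fun n =>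
          lintegral_enorm_sub_average_sq_le_of_testPairs k (W (σ n)) (hw (σ n)))
    _ = _ := (ENNReal.Tendsto.const_mul (ENNReal.tendsto_ofReal hE)
        (Or.inr (ENNReal.pow_ne_top ENNReal.ofReal_ne_top))).liminf_eq

/-- Where `u` is large, either its local average is large, or `u` differs much from this average;
the latter set is small. -/
theorem measure_le_abs_toFun_le (k : ℕ) (u : D12 N) {a : ℝ} (ha : 0 < a) {μ : Measure (Eucl N)}
    (hμ : μ ≤ volume) :
    μ {x | a ≤ |D12.toFun u x|} ≤
      ENNReal.ofReal (4 * D12.energy u / (a ^ 2 * (k + 1) ^ 2)) +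
        μ {x | a / 2 ≤ |average k (D12.shift x u)|} := by
  have hsub : {x | a ≤ |D12.toFun u x|} ⊆
      {x | ENNReal.ofReal (a / 2) ^ 2 ≤ ‖D12.toFun u x - average k (D12.shift x u)‖ₑ ^ 2} ∪
        {x | a / 2 ≤ |average k (D12.shift x u)|} := by
    intro x hx
    by_contra hcon
    simp only [Set.mem_union, Set.mem_ofPred_eq, not_or, not_le] at hcon hx
    obtain ⟨h1, h2⟩ := hcon
    have h3 : |D12.toFun u x - average k (D12.shift x u)| < a / 2 := by
      rw [← Real.norm_eq_abs, ← ENNReal.ofReal_lt_ofReal_iff (by positivity), ofReal_norm]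
      exact lt_of_not_ge fun h => absurd (pow_le_pow_left' h 2) (not_le.2 h1)
    have := abs_sub_abs_le_abs_sub (D12.toFun u x) (average k (D12.shift x u))
    linarith
  refine (measure_mono hsub).trans ((measure_union_le _ _).trans ?_)
  gcongr
  refine (hμ _).trans ?_
  have ha2 : (0 : ℝ) < a / 2 := by positivity
  refine (meas_ge_le_lintegral_div (((stronglyMeasurable_toFun u).sub
    (stronglyMeasurable_average_shift k u)).enorm.pow_const 2).aemeasurable
    (by simpa using ha) (ENNReal.pow_ne_top ENNReal.ofReal_ne_top)).trans ?_
  refine (ENNReal.div_le_div_right (lintegral_enorm_toFun_sub_average_sq_le k u) _).trans ?_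
  have hE : 0 ≤ D12.energy u := by rw [energy_eq_norm_sq]; positivity
  rw [← ENNReal.ofReal_pow (by positivity), ← ENNReal.ofReal_pow (by positivity),
    ← ENNReal.ofReal_mul (by positivity), ← ENNReal.ofReal_div_of_pos (by positivity)]
  refine ENNReal.ofReal_le_ofReal (le_of_eq ?_)
  field_simp
  ring

end Average

/-! ### Nonlinearities of critical growth -/

section Growth

/-- The growth condition `|Ψ'(s)| ≤ C |s|^{p-1}` for a differentiable `Ψ` with `Ψ(0) = 0`,
where `p > 1`. -/
structure HasGrowth (Ψ : ℝ → ℝ) (p C : ℝ) : Prop where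
  one_lt : 1 < p
  differentiable : Differentiable ℝ Ψ
  map_zero : Ψ 0 = 0
  abs_deriv_le : ∀ s, |deriv Ψ s| ≤ C * |s| ^ (p - 1)

variable {Ψ : ℝ → ℝ} {p C : ℝ}

namespace HasGrowth

theorem nonneg (h : HasGrowth Ψ p C) : 0 ≤ C := by
  simpa using (abs_nonneg _).trans (h.abs_deriv_le 1)

theorem abs_add_sub_le (h : HasGrowth Ψ p C) (a b : ℝ) :
    |Ψ (a + b) - Ψ a| ≤ C * (|a| + |b|) ^ (p - 1) * |b| := by
  have hp : 0 ≤ p - 1 := by linarith [h.one_lt]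
  have key := (convex_Icc (-(|a| + |b|)) (|a| + |b|)).norm_image_sub_le_of_norm_deriv_le
    (f := Ψ) (C := C * (|a| + |b|) ^ (p - 1)) (x := a) (y := a + b)
    (fun x _ => h.differentiable x) (fun x hx => by
      refine (h.abs_deriv_le x).trans ?_
      have := h.nonneg
      gcongr
      exact abs_le.2 hx) (abs_le.1 (by linarith [abs_nonneg b])) (abs_le.1 (abs_add_le a b))
  simpa using key

theorem abs_apply_le (h : HasGrowth Ψ p C) (s : ℝ) : |Ψ s| ≤ C * |s| ^ p := by
  have := h.abs_add_sub_le 0 s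
  rw [zero_add, h.map_zero, sub_zero, abs_zero, zero_add, mul_assoc,
    ← Real.rpow_add_one' (abs_nonneg s) (by linarith [h.one_lt]), sub_add_cancel] at this
  exact this

/-- The interaction of `a` and `b` under `Ψ` is an arbitrarily small multiple of `|a|^p`, up to a
multiple of `|b|^p`: compare `|b|` with a small multiple `κ |a|`. -/
theorem exists_interaction_le (h : HasGrowth Ψ p C) {δ : ℝ} (hδ : 0 < δ) :
    ∃ K, 0 ≤ K ∧ ∀ a b, |Ψ (a + b) - Ψ a - Ψ b| ≤ δ * |a| ^ p + K * |b| ^ p := by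
  have hp : 0 ≤ p - 1 := by linarith [h.one_lt]
  have hp' : p - 1 + 1 ≠ 0 := by linarith [h.one_lt]
  have hC := h.nonneg
  obtain ⟨κ, hκ, hκ1, hκδ⟩ : ∃ κ > 0, κ ≤ 1 ∧ C * 2 ^ (p - 1) * κ ≤ δ := by
    have hD : 0 ≤ C * 2 ^ (p - 1) := by positivity
    refine ⟨min 1 (δ / (C * 2 ^ (p - 1) + 1)), by positivity, min_le_left _ _, ?_⟩
    calc _ ≤ C * 2 ^ (p - 1) * (δ / (C * 2 ^ (p - 1) + 1)) := by
          gcongr; exact min_le_right _ _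
      _ ≤ δ := by
          rw [mul_div_assoc', div_le_iff₀ (by positivity)]
          nlinarith
  refine ⟨C * (1 / κ + 1) ^ (p - 1) + C, by positivity, fun a b => ?_⟩
  have h1 : |Ψ (a + b) - Ψ a| ≤ δ * |a| ^ p + C * (1 / κ + 1) ^ (p - 1) * |b| ^ p := by
    refine (h.abs_add_sub_le a b).trans ?_
    rcases le_total |b| (κ * |a|) with hb | hb
    · have hba : |b| ≤ |a| := hb.trans (mul_le_of_le_one_left (abs_nonneg a) hκ1)
      have : C * (|a| + |b|) ^ (p - 1) * |b| ≤ δ * |a| ^ p := by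
        calc _ ≤ C * (2 * |a|) ^ (p - 1) * (κ * |a|) := by
              gcongr; linarith
          _ = C * 2 ^ (p - 1) * κ * (|a| ^ (p - 1) * |a|) := by
              rw [Real.mul_rpow zero_le_two (abs_nonneg a)]; ring
          _ ≤ δ * (|a| ^ (p - 1) * |a|) := by gcongr
          _ = δ * |a| ^ p := by
              rw [← Real.rpow_add_one' (abs_nonneg a) hp', sub_add_cancel]
      exact this.trans (le_add_of_nonneg_right (by positivity))
    · have hab : |a| ≤ 1 / κ * |b| := by
        rw [one_div, inv_mul_eq_div, le_div_iff₀ hκ]; linarith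
      have : C * (|a| + |b|) ^ (p - 1) * |b| ≤ C * (1 / κ + 1) ^ (p - 1) * |b| ^ p := by
        calc _ ≤ C * ((1 / κ + 1) * |b|) ^ (p - 1) * |b| := by
              gcongr; linarith
          _ = C * (1 / κ + 1) ^ (p - 1) * (|b| ^ (p - 1) * |b|) := by
              rw [Real.mul_rpow (by positivity) (abs_nonneg b)]; ring
          _ = _ := by
              rw [← Real.rpow_add_one' (abs_nonneg b) hp', sub_add_cancel]
      exact this.trans (le_add_of_nonneg_left (by positivity))
  have h2 := abs_sub (Ψ (a + b) - Ψ a) (Ψ b)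
  have h3 := h.abs_apply_le b
  rw [add_mul]
  linarith

theorem integrable_comp (h : HasGrowth Ψ p C) {α : Type*} [MeasurableSpace α] {μ : Measure α}
    {f : α → ℝ} (hf : AEStronglyMeasurable f μ) (hfp : Integrable (fun x => |f x| ^ p) μ) :
    Integrable (fun x => Ψ (f x)) μ :=
  (hfp.const_mul C).mono' (h.differentiable.continuous.comp_aestronglyMeasurable hf)
    (Eventually.of_forall fun x => h.abs_apply_le (f x))

/-- The Brezis–Lieb splitting: if `f n → 0` almost everywhere and is bounded in `L^p`, then the
interaction of `f n` with a fixed `g ∈ L^p` disappears in the limit. -/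
theorem tendsto_integral_add_sub (h : HasGrowth Ψ p C) {α : Type*} [MeasurableSpace α]
    {μ : Measure α} {f : ℕ → α → ℝ} {g : α → ℝ} (hf : ∀ n, AEStronglyMeasurable (f n) μ)
    (hg : AEStronglyMeasurable g μ) (hfp : ∀ n, Integrable (fun x => |f n x| ^ p) μ)
    (hgp : Integrable (fun x => |g x| ^ p) μ)
    (hfg : ∀ n, Integrable (fun x => |f n x + g x| ^ p) μ) {A : ℝ}
    (hA : ∀ n, ∫ x, |f n x| ^ p ∂μ ≤ A)
    (hlim : ∀ᵐ x ∂μ, Tendsto (fun n => f n x) atTop (𝓝 0)) :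
    Tendsto (fun n => ∫ x, Ψ (f n x + g x) ∂μ - ∫ x, Ψ (f n x) ∂μ) atTop
      (𝓝 (∫ x, Ψ (g x) ∂μ)) := by
  have hc := h.differentiable.continuous
  have i1 := fun n => h.integrable_comp ((hf n).add hg) (hfg n)
  have i2 := fun n => h.integrable_comp (hf n) (hfp n)
  have i3 := h.integrable_comp hg hgp
  have i4 : ∀ n, Integrable (fun x => Ψ (f n x + g x) - Ψ (f n x) - Ψ (g x)) μ :=
    fun n => ((i1 n).sub (i2 n)).sub i3
  have hA0 : 0 ≤ A := (integral_nonneg fun x => by positivity).trans (hA 0)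
  suffices H : Tendsto (fun n => ∫ x, (Ψ (f n x + g x) - Ψ (f n x) - Ψ (g x)) ∂μ) atTop (𝓝 0) by
    have := H.add_const (∫ x, Ψ (g x) ∂μ)
    rw [zero_add] at this
    refine this.congr fun n => ?_
    have e1 := integral_sub ((i1 n).sub (i2 n)) i3
    have e2 := integral_sub (i1 n) (i2 n)
    simp only [Pi.sub_apply, Pi.add_apply] at e1 e2
    rw [e1, e2]; ring
  rw [Metric.tendsto_nhds]
  intro ε hε
  obtain ⟨K, hK, hint⟩ := h.exists_interaction_le (show 0 < ε / 2 / (A + 1) by positivity)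
  set δ := ε / 2 / (A + 1) with hδ
  -- the part of the interaction which is not absorbed by `δ |f n|^p` is dominated by `K |g|^p`
  have hdom : Tendsto (fun n => ∫ x, max (|Ψ (f n x + g x) - Ψ (f n x) - Ψ (g x)| -
      δ * |f n x| ^ p) 0 ∂μ) atTop (𝓝 (∫ _, (0 : ℝ) ∂μ)) := by
    refine tendsto_integral_of_dominated_convergence (fun x => K * |g x| ^ p)
      (fun n => ((i4 n).abs.sub ((hfp n).const_mul δ)).aestronglyMeasurable.sup
        aestronglyMeasurable_const) (hgp.const_mul K) (fun n => Eventually.of_forall fun x => ?_) ?_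
    · rw [Real.norm_eq_abs, abs_of_nonneg (le_max_right _ _)]
      exact max_le (by linarith [hint (f n x) (g x)]) (by positivity)
    · filter_upwards [hlim] with x hx
      have t1 : Tendsto (fun n => Ψ (f n x + g x)) atTop (𝓝 (Ψ (g x))) :=
        (hc.tendsto _).comp (by simpa using hx.add_const (g x))
      have t2 : Tendsto (fun n => Ψ (f n x)) atTop (𝓝 0) := by
        rw [← h.map_zero]; exact (hc.tendsto 0).comp hx
      have t3 : Tendsto (fun n => |f n x| ^ p) atTop (𝓝 0) := by
        have := hx.abs.rpow_const (p := p) (Or.inr (by linarith [h.one_lt]))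
        rwa [abs_zero, Real.zero_rpow (by linarith [h.one_lt])] at this
      have t4 := ((((t1.sub t2).sub_const (Ψ (g x))).abs.sub (t3.const_mul δ)).max
        (tendsto_const_nhds (x := (0 : ℝ))))
      simpa using t4
  rw [integral_zero] at hdom
  filter_upwards [Metric.tendsto_nhds.1 hdom (ε / 2) (by positivity)] with n hn
  rw [Real.dist_eq, sub_zero] at hn ⊢
  have iM : Integrable (fun x => max (|Ψ (f n x + g x) - Ψ (f n x) - Ψ (g x)| -
      δ * |f n x| ^ p) 0) μ := ((i4 n).abs.sub ((hfp n).const_mul δ)).pos_part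
  calc _ ≤ ∫ x, |Ψ (f n x + g x) - Ψ (f n x) - Ψ (g x)| ∂μ := abs_integral_le_integral_abs
    _ ≤ ∫ x, (max (|Ψ (f n x + g x) - Ψ (f n x) - Ψ (g x)| - δ * |f n x| ^ p) 0 +
        δ * |f n x| ^ p) ∂μ :=
        integral_mono (i4 n).abs (iM.add ((hfp n).const_mul δ)) fun x => by
          have := le_max_left (|Ψ (f n x + g x) - Ψ (f n x) - Ψ (g x)| - δ * |f n x| ^ p) 0
          simp only
          linarith
    _ = ∫ x, max (|Ψ (f n x + g x) - Ψ (f n x) - Ψ (g x)| - δ * |f n x| ^ p) 0 ∂μ +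
        δ * ∫ x, |f n x| ^ p ∂μ := by
        rw [integral_add iM ((hfp n).const_mul δ), integral_const_mul]
    _ < ε / 2 + ε / 2 := by
        have h1 := (abs_lt.1 hn).2
        have h2 : δ * ∫ x, |f n x| ^ p ∂μ ≤ ε / 2 := by
          calc _ ≤ δ * (A + 1) := by
                have := hA n
                gcongr; linarith
            _ = ε / 2 := by rw [hδ]; field_simp
        linarith
    _ = ε := by ring

end HasGrowth

end Growth

/-! ### Weak convergence and nonlinear integrals -/

section Nonlinear

variable {N : ℕ} [hN : Fact (3 ≤ N)]

/-- A finite measure with the null sets of Lebesgue measure and bounded by it, so that convergence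
in Lebesgue measure and convergence almost everywhere both imply convergence in this measure. -/
theorem exists_finite_measure_le (N : ℕ) : ∃ μ : Measure (Eucl N), IsFiniteMeasure μ ∧
    μ ≤ volume ∧ volume ≪ μ := by
  have hfin := finite_integral_one_add_norm (E := Eucl N) (μ := volume) (r := N + 1) (by simp)
  set d : Eucl N → ℝ≥0∞ := fun x => ENNReal.ofReal ((1 + ‖x‖) ^ (-((N : ℝ) + 1)))
  refine ⟨volume.withDensity d, isFiniteMeasure_withDensity hfin.ne, ?_, ?_⟩
  · calc volume.withDensity d ≤ volume.withDensity 1 := by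
          refine withDensity_mono (Eventually.of_forall fun x => ?_)
          refine ENNReal.ofReal_le_one.2 (Real.rpow_le_one_of_one_le_of_nonpos ?_ ?_)
          · linarith [norm_nonneg x]
          · linarith [(Nat.cast_nonneg N : (0 : ℝ) ≤ N)]
      _ = volume := withDensity_one
  · refine withDensity_absolutelyContinuous' ?_ (Eventually.of_forall fun x => ?_)
    · refine (Measurable.ennreal_ofReal ?_).aemeasurable
      exact Measurable.pow_const (by fun_prop) _
    · exact (ENNReal.ofReal_pos.2 (by positivity)).ne'

/-- A bounded sequence converging weakly to zero in `D^{1,2}` converges to zero almost everywhere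
along a subsequence. Its averages over small balls converge pointwise, and it is close to its
averages in measure. -/
theorem WeakTo.exists_seq_tendsto_ae {w : ℕ → D12 N} (h : WeakTo atTop w 0) {M : ℝ}
    (hM : ∀ n, ‖gradMap N (w n)‖ ≤ M) :
    ∃ σ : ℕ → ℕ, StrictMono σ ∧
      ∀ᵐ x ∂(volume : Measure (Eucl N)), Tendsto (fun n => D12.toFun (w (σ n)) x) atTop (𝓝 0) := by
  obtain ⟨μ, hfin, hle, hac⟩ := exists_finite_measure_le N
  have hmeas : TendstoInMeasure μ (fun n => D12.toFun (w n)) atTop (fun _ => (0 : ℝ)) := by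
    rw [tendstoInMeasure_iff_norm]
    intro a ha
    rw [ENNReal.tendsto_nhds_zero]
    intro ε hε
    simp only [sub_zero, Real.norm_eq_abs]
    have ht : Tendsto (fun k : ℕ => ENNReal.ofReal (4 * M ^ 2 / (a ^ 2 * ((k : ℝ) + 1) ^ 2)))
        atTop (𝓝 0) := by
      rw [← ENNReal.ofReal_zero]
      refine ENNReal.tendsto_ofReal (Tendsto.div_atTop tendsto_const_nhds ?_)
      refine Tendsto.const_mul_atTop (by positivity) ((tendsto_pow_atTop two_ne_zero).comp ?_)
      exact tendsto_atTop_add_const_right _ _ tendsto_natCast_atTop_atTop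
    have hε2 : (0 : ℝ≥0∞) < ε / 2 := ENNReal.half_pos hε.ne'
    obtain ⟨k, hk⟩ := (ht.eventually_lt_const hε2).exists
    obtain ⟨C, -, hC⟩ := exists_average_le N k
    have hav : TendstoInMeasure μ (fun n x => average k (D12.shift x (w n))) atTop
        (fun _ => (0 : ℝ)) := by
      refine tendstoInMeasure_of_tendsto_ae
        (fun n => (stronglyMeasurable_average_shift k (w n)).aestronglyMeasurable)
        (Eventually.of_forall fun x => ?_)
      have := (h.shift x).functional (average k) hC
      rwa [← shiftMap_apply x 0, map_zero, map_zero] at this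
    rw [tendstoInMeasure_iff_norm] at hav
    filter_upwards [(hav (a / 2) (by positivity)).eventually_lt_const hε2] with n hn
    simp only [sub_zero, Real.norm_eq_abs] at hn
    refine (measure_le_abs_toFun_le k (w n) ha hle).trans ?_
    rw [← ENNReal.add_halves ε]
    refine add_le_add ((ENNReal.ofReal_le_ofReal ?_).trans hk.le) hn.le
    rw [energy_eq_norm_sq]
    have := hM n
    gcongr
  obtain ⟨σ, hσ, hae⟩ := hmeas.exists_seq_tendsto_ae
  exact ⟨σ, hσ, hac.ae_le hae⟩

theorem integrable_abs_toFun_rpow (u : D12 N) :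
    Integrable (fun x => |D12.toFun u x| ^ critExp N) volume := by
  have h0 : 0 < critExp N := zero_lt_one.trans (critExp_gt_one N)
  have := (Lp.memLp u.1.1).integrable_norm_rpow (by simpa using h0) ENNReal.ofReal_ne_top
  rwa [ENNReal.toReal_ofReal h0.le] at this

theorem integral_abs_toFun_rpow_le (u : D12 N) :
    ∫ x, |D12.toFun u x| ^ critExp N ≤ (sobolevConst N * ‖gradMap N u‖) ^ critExp N := by
  have h0 : 0 < critExp N := zero_lt_one.trans (critExp_gt_one N)
  have h := (Lp.memLp u.1.1).eLpNorm_eq_integral_rpow_norm (by simpa using h0) ENNReal.ofReal_ne_top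
  rw [ENNReal.toReal_ofReal h0.le] at h
  have hI : 0 ≤ ∫ x, |D12.toFun u x| ^ critExp N := integral_nonneg fun x => by positivity
  have h1 : ‖u.1.1‖ = (∫ x, |D12.toFun u x| ^ critExp N) ^ (critExp N)⁻¹ := by
    rw [Lp.norm_def, h]
    exact ENNReal.toReal_ofReal (Real.rpow_nonneg hI _)
  rw [← Real.rpow_inv_rpow hI h0.ne', ← h1]
  have := norm_fst_le u
  gcongr

theorem toFun_add (u v : D12 N) :
    D12.toFun (u + v) =ᵐ[volume] fun x => D12.toFun u x + D12.toFun v x :=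
  Lp.coeFn_add u.1.1 v.1.1

theorem nonlinInt_shift (Ψ : ℝ → ℝ) (y : Eucl N) (u : D12 N) :
    nonlinInt Ψ (D12.shift y u) = nonlinInt Ψ u := by
  unfold nonlinInt
  rw [← integral_add_right_eq_self (fun x => Ψ (D12.toFun u x)) y]
  refine integral_congr_ae ?_
  filter_upwards [toFun_shift y u] with x hx
  rw [hx]

theorem HasGrowth.integrable_toFun {Ψ : ℝ → ℝ} {C : ℝ} (h : HasGrowth Ψ (critExp N) C)
    (u : D12 N) : Integrable (fun x => Ψ (D12.toFun u x)) volume :=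
  h.integrable_comp (stronglyMeasurable_toFun u).aestronglyMeasurable (integrable_abs_toFun_rpow u)

/-- Weak convergence splits the nonlinear integral. -/
theorem HasGrowth.tendsto_nonlinInt_sub {Ψ : ℝ → ℝ} {C : ℝ} (h : HasGrowth Ψ (critExp N) C)
    {w : ℕ → D12 N} {v : D12 N} (hw : WeakTo atTop w v) {M : ℝ}
    (hM : ∀ n, ‖gradMap N (w n)‖ ≤ M) :
    Tendsto (fun n => nonlinInt Ψ (w n) - nonlinInt Ψ (w n - v)) atTop (𝓝 (nonlinInt Ψ v)) := by
  have h0 : 0 < critExp N := zero_lt_one.trans (critExp_gt_one N)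
  have hz : WeakTo atTop (fun n => w n - v) 0 := by
    simpa only [sub_self] using hw.sub (WeakTo.const v)
  have hzM : ∀ n, ‖gradMap N (w n - v)‖ ≤ M + ‖gradMap N v‖ := fun n => by
    rw [map_sub]
    exact (norm_sub_le _ _).trans (add_le_add_left (hM n) _)
  refine tendsto_of_subseq_tendsto fun ns hns => ?_
  have hz' : WeakTo atTop (fun n => w (ns n) - v) 0 := fun g => (hz g).comp hns
  obtain ⟨σ, -, hae⟩ := hz'.exists_seq_tendsto_ae fun n => hzM (ns n)
  refine ⟨σ, ?_⟩
  have hadd : ∀ n, D12.toFun (w n) =ᵐ[volume]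
      fun x => D12.toFun (w n - v) x + D12.toFun v x := fun n => by
    have := toFun_add (w n - v) v
    rwa [sub_add_cancel] at this
  have key := h.tendsto_integral_add_sub (μ := volume)
    (f := fun n => D12.toFun (w (ns (σ n)) - v)) (g := D12.toFun v)
    (fun n => (stronglyMeasurable_toFun _).aestronglyMeasurable)
    (stronglyMeasurable_toFun _).aestronglyMeasurable
    (fun n => integrable_abs_toFun_rpow _) (integrable_abs_toFun_rpow _)
    (fun n => (integrable_abs_toFun_rpow (w (ns (σ n)))).congr
      ((hadd (ns (σ n))).mono fun x hx => by simp only [hx]))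
    (A := (sobolevConst N * (M + ‖gradMap N v‖)) ^ critExp N)
    (fun n => (integral_abs_toFun_rpow_le _).trans (by
      have := hzM (ns (σ n))
      have := sobolevConst_nonneg N
      gcongr)) hae
  refine key.congr fun n => ?_
  congr 1
  exact integral_congr_ae ((hadd (ns (σ n))).mono fun x hx => by simp only [hx])

/-- A nonlinearity negligible at zero and at infinity is a small multiple of the critical power, up
to a bounded contribution of the set where the argument is not small. -/
theorem HasGrowth.exists_le_indicator {Ψ : ℝ → ℝ} {C : ℝ} (h : HasGrowth Ψ (critExp N) C)
    (hs : SubcriticalAtZeroAndInfinity N Ψ) {δ : ℝ} (hδ : 0 < δ) :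
    ∃ a > 0, ∃ K, 0 ≤ K ∧ ∀ s,
      |Ψ s| ≤ δ * |s| ^ critExp N + {s : ℝ | a ≤ |s|}.indicator (fun _ => K) s := by
  have hC := h.nonneg
  have h0 : 0 < critExp N := zero_lt_one.trans (critExp_gt_one N)
  have small : ∀ s : ℝ, s ≠ 0 → dist (Ψ s / |s| ^ critExp N) 0 < δ →
      |Ψ s| ≤ δ * |s| ^ critExp N := by
    intro s hs0 hd
    have hpos : 0 < |s| ^ critExp N := Real.rpow_pos_of_pos (abs_pos.2 hs0) _
    rw [Real.dist_eq, sub_zero, abs_div, abs_of_pos hpos, div_lt_iff₀ hpos] at hd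
    exact hd.le
  obtain ⟨h1, h2⟩ := hs
  obtain ⟨a, ha, haδ⟩ := Metric.eventually_nhds_iff.1
    (eventually_nhdsWithin_iff.1 (Metric.tendsto_nhds.1 h1 δ hδ))
  obtain ⟨h3, h4⟩ := eventually_sup.1 (Metric.tendsto_nhds.1 h2 δ hδ)
  obtain ⟨b₁, hb₁⟩ := eventually_atBot.1 h3
  obtain ⟨b₂, hb₂⟩ := eventually_atTop.1 h4
  set b := max (max (-b₁) b₂) 1
  have hb : 1 ≤ b := le_max_right _ _
  refine ⟨a, ha, C * b ^ critExp N, by positivity, fun s => ?_⟩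
  by_cases hsa : a ≤ |s|
  · rw [Set.indicator_of_mem (show s ∈ {s : ℝ | a ≤ |s|} from hsa)]
    have hs0 : s ≠ 0 := by rintro rfl; simp at hsa; linarith
    rcases le_total |s| b with hsb | hsb
    · refine (h.abs_apply_le s).trans ?_
      have : C * |s| ^ critExp N ≤ C * b ^ critExp N := by gcongr
      have : 0 ≤ δ * |s| ^ critExp N := by positivity
      linarith
    · have : |Ψ s| ≤ δ * |s| ^ critExp N := by
        refine small s hs0 ?_
        rcases le_abs'.1 hsb with hs' | hs'
        · exact hb₁ s (by linarith [le_max_left (-b₁) b₂, le_max_left (max (-b₁) b₂) 1])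
        · exact hb₂ s (by linarith [le_max_right (-b₁) b₂, le_max_left (max (-b₁) b₂) 1])
      have : 0 ≤ C * b ^ critExp N := by positivity
      linarith
  · rw [Set.indicator_of_notMem (show s ∉ {s : ℝ | a ≤ |s|} from hsa), add_zero]
    by_cases hs0 : s = 0
    · rw [hs0, h.map_zero, abs_zero]; positivity
    · exact small s hs0 (haδ (by simpa using hsa) hs0)

/-- Lions' vanishing principle in quantitative form: if all averages of `v` over balls of radius
`1 / (k + 1)` are small, then so is the nonlinear integral, for `k` large. -/
theorem HasGrowth.exists_abs_nonlinInt_le {Ψ : ℝ → ℝ} {C : ℝ} (h : HasGrowth Ψ (critExp N) C)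
    (hs : SubcriticalAtZeroAndInfinity N Ψ) (M : ℝ) {ε : ℝ} (hε : 0 < ε) :
    ∃ k : ℕ, ∃ a > 0, ∀ v : D12 N, D12.energy v ≤ M →
      (∀ x, |average k (D12.shift x v)| < a) → |nonlinInt Ψ v| ≤ ε := by
  have h0 : 0 < critExp N := zero_lt_one.trans (critExp_gt_one N)
  set B := (sobolevConst N * Real.sqrt |M|) ^ critExp N with hB
  have hB0 : 0 ≤ B := Real.rpow_nonneg (mul_nonneg (sobolevConst_nonneg N) (Real.sqrt_nonneg _)) _
  obtain ⟨a, ha, K, hK, hle⟩ := h.exists_le_indicator hs (show 0 < ε / 2 / (B + 1) by positivity)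
  set δ := ε / 2 / (B + 1) with hδ
  have ht : Tendsto (fun k : ℕ => K * (4 * |M| / (a ^ 2 * ((k : ℝ) + 1) ^ 2))) atTop (𝓝 0) := by
    rw [← mul_zero K]
    refine (Tendsto.div_atTop tendsto_const_nhds ?_).const_mul K
    refine Tendsto.const_mul_atTop (by positivity) ((tendsto_pow_atTop two_ne_zero).comp ?_)
    exact tendsto_atTop_add_const_right _ _ tendsto_natCast_atTop_atTop
  obtain ⟨k, hk⟩ := (ht.eventually_lt_const (show (0 : ℝ) < ε / 2 by positivity)).exists
  refine ⟨k, a / 2, by positivity, fun v hv hav => ?_⟩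
  set S := {x | a ≤ |D12.toFun v x|}
  have hvM : D12.energy v ≤ |M| := hv.trans (le_abs_self M)
  have hS : volume S ≤ ENNReal.ofReal (4 * |M| / (a ^ 2 * ((k : ℝ) + 1) ^ 2)) := by
    refine (measure_le_abs_toFun_le k v ha le_rfl).trans ?_
    have : {x | a / 2 ≤ |average k (D12.shift x v)|} = ∅ := by
      ext x; simpa using hav x
    rw [this, measure_empty, add_zero]
    exact ENNReal.ofReal_le_ofReal (by gcongr)
  have hSm : MeasurableSet S :=
    measurableSet_le measurable_const (stronglyMeasurable_toFun v).measurable.abs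
  have hSr : volume.real S ≤ 4 * |M| / (a ^ 2 * ((k : ℝ) + 1) ^ 2) :=
    ENNReal.toReal_le_of_le_ofReal (by positivity) hS
  have iS : Integrable (S.indicator fun _ => K) volume :=
    (integrable_indicator_iff hSm).2
      (integrableOn_const (hS.trans_lt ENNReal.ofReal_lt_top).ne)
  have iv := integrable_abs_toFun_rpow v
  have hint : ∫ x, |D12.toFun v x| ^ critExp N ≤ B := by
    refine (integral_abs_toFun_rpow_le v).trans ?_
    have h1 : ‖gradMap N v‖ ≤ Real.sqrt |M| :=
      Real.le_sqrt_of_sq_le (by rwa [← energy_eq_norm_sq])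
    have := sobolevConst_nonneg N
    rw [hB]; gcongr
  calc |nonlinInt Ψ v| ≤ ∫ x, |Ψ (D12.toFun v x)| := abs_integral_le_integral_abs
    _ ≤ ∫ x, (δ * |D12.toFun v x| ^ critExp N + S.indicator (fun _ => K) x) :=
        integral_mono (h.integrable_toFun v).abs ((iv.const_mul δ).add iS)
          fun x => hle (D12.toFun v x)
    _ = δ * (∫ x, |D12.toFun v x| ^ critExp N) + K * volume.real S := by
        rw [integral_add (iv.const_mul δ) iS, integral_const_mul, integral_indicator_const _ hSm,
          smul_eq_mul, mul_comm K]
    _ ≤ δ * (B + 1) + K * (4 * |M| / (a ^ 2 * ((k : ℝ) + 1) ^ 2)) := by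
        gcongr
        linarith
    _ ≤ ε / 2 + ε / 2 := by
        gcongr
        exact le_of_eq (by rw [hδ]; field_simp)
    _ = ε := by ring

end Nonlinear

/-! ### Weak limits of the remainders -/

section Remainder

variable {N : ℕ} [hN : Fact (3 ≤ N)]

/-- The remainder `u - ∑_{j < m} U_j(· - y^j)` after removal of the first `m` profiles. -/
def partialRemainder (u : D12 N) (U : ℕ → D12 N) (y : ℕ → Eucl N) (m : ℕ) : D12 N :=
  u - ∑ j ∈ Finset.range m, D12.shift (-(y j)) (U j)

theorem partialRemainder_zero (u : D12 N) (U : ℕ → D12 N) (y : ℕ → Eucl N) :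
    partialRemainder u U y 0 = u := by
  simp [partialRemainder]

theorem partialRemainder_succ (u : D12 N) (U : ℕ → D12 N) (y : ℕ → Eucl N) (m : ℕ) :
    partialRemainder u U y (m + 1) = partialRemainder u U y m - D12.shift (-(y m)) (U m) := by
  rw [partialRemainder, Finset.sum_range_succ, ← sub_sub]; rfl

theorem shift_partialRemainder (z : Eucl N) (u : D12 N) (U : ℕ → D12 N) (y : ℕ → Eucl N) (m : ℕ) :
    D12.shift z (partialRemainder u U y m) =
      D12.shift z u - ∑ j ∈ Finset.range m, D12.shift (z - y j) (U j) := by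
  simp only [partialRemainder, ← shiftMap_apply, map_sub, map_sum]
  simp only [shiftMap_apply, shift_shift, sub_eq_add_neg]

theorem shift_partialRemainder_succ (u : D12 N) (U : ℕ → D12 N) (y : ℕ → Eucl N) (m : ℕ) :
    D12.shift (y m) (partialRemainder u U y (m + 1)) =
      D12.shift (y m) (partialRemainder u U y m) - U m := by
  rw [partialRemainder_succ, shift_sub, shift_shift, add_neg_cancel, shift_zero]

theorem norm_gradMap_partialRemainder_le (u : D12 N) (U : ℕ → D12 N) (y : ℕ → Eucl N) (m : ℕ)
    {M : ℝ} (hM : ‖gradMap N u‖ ≤ M) :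
    ‖gradMap N (partialRemainder u U y m)‖ ≤ M + ∑ j ∈ Finset.range m, ‖gradMap N (U j)‖ := by
  rw [partialRemainder, map_sub, map_sum]
  refine (norm_sub_le _ _).trans (add_le_add hM ((norm_sum_le _ _).trans (le_of_eq ?_)))
  exact Finset.sum_congr rfl fun j _ => norm_gradMap_shift _ _

variable {l : Filter ℕ} {u : ℕ → D12 N} {U : ℕ → D12 N} {y : ℕ → ℕ → Eucl N}

/-- Seen from a point escaping from all centers `y^j`, `j < m`, the remainder has the same weak
limit as the original sequence. -/
theorem WeakTo.shift_partialRemainder {z : ℕ → Eucl N} {W : D12 N} {m : ℕ}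
    (hz : ∀ j < m, Tendsto (fun n => ‖z n - y j n‖) l atTop)
    (hW : WeakTo l (fun n => D12.shift (z n) (u n)) W) :
    WeakTo l (fun n => D12.shift (z n) (partialRemainder (u n) U (fun j => y j n) m)) W := by
  simp only [ProfileDecomposition.shift_partialRemainder]
  have := hW.sub (WeakTo.sum (s := Finset.range m) (v := fun _ => 0) fun j hj =>
    WeakTo.shift_escaping (hz j (Finset.mem_range.1 hj)) (U j))
  simpa only [Finset.sum_const_zero, sub_zero] using this

/-- Seen from a center whose profile has been removed, the remainder vanishes weakly. -/
theorem weakTo_shift_partialRemainder_zero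
    (hy : ∀ i j, i ≠ j → Tendsto (fun n => ‖y i n - y j n‖) l atTop)
    (hU : ∀ i, WeakTo l (fun n => D12.shift (y i n) (u n)) (U i)) {i m : ℕ} (him : i < m) :
    WeakTo l (fun n => D12.shift (y i n) (partialRemainder (u n) U (fun j => y j n) m)) 0 := by
  simp only [ProfileDecomposition.shift_partialRemainder]
  have := (hU i).sub (WeakTo.sum (s := Finset.range m)
    (u := fun j n => D12.shift (y i n - y j n) (U j)) (v := fun j => if j = i then U i else 0)
    fun j _ => by
      by_cases hji : j = i
      · subst hji
        simp only [sub_self, shift_zero, if_true]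
        exact WeakTo.const _
      · rw [if_neg hji]
        exact WeakTo.shift_escaping (hy i j (Ne.symm hji)) (U j))
  simpa only [Finset.sum_ite_eq', Finset.mem_range, him, if_true, sub_self] using this

end Remainder

/-! ### Greedy choice of the centers along an ultrafilter -/

theorem exists_forall_le_two_mul {α : Type*} {s : Set α} (hs : s.Nonempty) {f : α → ℝ}
    (hf : ∀ a, 0 ≤ f a) {B : ℝ} (hB : ∀ a, f a ≤ B) : ∃ a ∈ s, ∀ b ∈ s, f b ≤ 2 * f a := by
  have hbdd : BddAbove (f '' s) := ⟨B, by rintro _ ⟨a, -, rfl⟩; exact hB a⟩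
  rcases le_or_gt (sSup (f '' s)) 0 with h | h
  · obtain ⟨a, ha⟩ := hs
    exact ⟨a, ha, fun b hb => by
      have := le_csSup hbdd (Set.mem_image_of_mem f hb)
      linarith [hf a]⟩
  · obtain ⟨_, ⟨a, ha, rfl⟩, hlt⟩ := exists_lt_of_lt_csSup (hs.image f) (half_lt_self h)
    exact ⟨a, ha, fun b hb => by
      have := le_csSup hbdd (Set.mem_image_of_mem f hb)
      linarith⟩

/-- A sequence each of whose terms is, up to a factor two, the best candidate for `f` among those in
relation `r` to all previous terms. -/
theorem exists_greedy_seq {α : Type*} (r : α → α → Prop) (f : α → ℝ) (y₀ : α)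
    (h : ∀ s : Set α, s.Finite →
      ∃ y, (∀ z ∈ s, r y z) ∧ ∀ y', (∀ z ∈ s, r y' z) → f y' ≤ 2 * f y) :
    ∃ Y : ℕ → α, Y 0 = y₀ ∧ ∀ i, (∀ j ≤ i, r (Y (i + 1)) (Y j)) ∧
      ∀ y', (∀ j ≤ i, r y' (Y j)) → f y' ≤ 2 * f (Y (i + 1)) := by
  have : Nonempty α := ⟨y₀⟩
  choose! pick hpick using h
  -- the state consists of the set of terms used so far and the last term
  let F : ℕ → Set α × α := fun n =>
    n.rec ({y₀}, y₀) fun _ q => (insert (pick q.1) q.1, pick q.1)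
  have hF : ∀ i, (F i).1 = (fun j => (F j).2) '' Set.Iic i := by
    intro i
    induction i with
    | zero =>
      have : Set.Iic 0 = {0} := by ext; simp
      rw [this, Set.image_singleton]; rfl
    | succ i ih =>
      have : Set.Iic (i + 1) = insert (i + 1) (Set.Iic i) := by
        ext j; simp only [Set.mem_Iic, Set.mem_insert_iff]; omega
      rw [this, Set.image_insert_eq, ← ih]
  have hfin : ∀ i, (F i).1.Finite := fun i => by
    rw [hF]; exact (Set.finite_Iic i).image _
  refine ⟨fun i => (F i).2, rfl, fun i => ⟨fun j hj => ?_, fun y' hy' => ?_⟩⟩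
  · exact (hpick _ (hfin i)).1 _ (by rw [hF]; exact Set.mem_image_of_mem _ hj)
  · refine (hpick _ (hfin i)).2 y' fun z hz => ?_
    rw [hF] at hz
    obtain ⟨j, hj, rfl⟩ := hz
    exact hy' j hj

/-- Along an ultrafilter, a sequence of points either escapes or converges. -/
theorem tendsto_norm_atTop_or_exists_tendsto {N : ℕ} (𝒰 : Ultrafilter ℕ) (z : ℕ → Eucl N) :
    Tendsto (fun n => ‖z n‖) 𝒰 atTop ∨ ∃ z₀, Tendsto z 𝒰 (𝓝 z₀) := by
  by_cases h : Tendsto (fun n => ‖z n‖) 𝒰 atTop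
  · exact Or.inl h
  · right
    rw [tendsto_atTop] at h
    push Not at h
    obtain ⟨b, hb⟩ := h
    have hb' : ∀ᶠ n in (𝒰 : Filter ℕ), z n ∈ Metric.closedBall (0 : Eucl N) b := by
      filter_upwards [hb] with n hn
      simpa using hn.le
    obtain ⟨z₀, -, hz₀⟩ := (isCompact_closedBall (0 : Eucl N) b).ultrafilter_le_nhds (𝒰.map z)
      (le_principal_iff.2 (mem_map.2 hb'))
    exact ⟨z₀, hz₀⟩

section Selection

variable {N : ℕ} [hN : Fact (3 ≤ N)]

theorem exists_escaping (l : Filter ℕ) (hl : l ≤ atTop) {s : Set (ℕ → Eucl N)} (hs : s.Finite) :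
    ∃ y : ℕ → Eucl N, ∀ z ∈ s, Tendsto (fun n => ‖y n - z n‖) l atTop := by
  have : Nonempty (Fin N) := ⟨⟨0, by have := hN.out; omega⟩⟩
  have : Nontrivial (Eucl N) := inferInstance
  have hex : ∀ n : ℕ, ∃ y : Eucl N, ‖y‖ = n + ∑ z ∈ hs.toFinset, ‖z n‖ := fun n =>
    exists_norm_eq _ (by positivity)
  choose y hy using hex
  refine ⟨y, fun z hz => Tendsto.mono_left (tendsto_atTop_mono (fun n => ?_)
    tendsto_natCast_atTop_atTop) hl⟩
  have h1 := norm_sub_norm_le (y n) (z n)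
  have h2 : ‖z n‖ ≤ ∑ z ∈ hs.toFinset, ‖z n‖ :=
    Finset.single_le_sum (f := fun z : ℕ → Eucl N => ‖z n‖) (fun _ _ => norm_nonneg _)
      (hs.mem_toFinset.2 hz)
  rw [hy] at h1
  linarith

/-- The supremum of the absolute values of the averages of `v` over balls of radius
`1 / (k + 1)`. -/
def supAverage (k : ℕ) (v : D12 N) : ℝ := ⨆ x, |average k (D12.shift x v)|

theorem bddAbove_average {k : ℕ} {C : ℝ} (hC : ∀ v : D12 N, |average k v| ≤ C * ‖gradMap N v‖)
    (v : D12 N) : BddAbove (Set.range fun x => |average k (D12.shift x v)|) :=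
  ⟨C * ‖gradMap N v‖, by
    rintro _ ⟨x, rfl⟩
    rw [← norm_gradMap_shift x]
    exact hC _⟩

theorem abs_average_shift_le_supAverage (k : ℕ) (v : D12 N) (x : Eucl N) :
    |average k (D12.shift x v)| ≤ supAverage k v := by
  obtain ⟨C, -, hC⟩ := exists_average_le N k
  exact le_ciSup (bddAbove_average hC v) x

theorem supAverage_nonneg (k : ℕ) (v : D12 N) : 0 ≤ supAverage k v :=
  (abs_nonneg _).trans (abs_average_shift_le_supAverage k v 0)

theorem exists_supAverage_le (k : ℕ) (v : D12 N) :
    ∃ x, supAverage k v / 2 ≤ |average k (D12.shift x v)| := by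
  rcases (supAverage_nonneg k v).eq_or_lt with h | h
  · exact ⟨0, by rw [← h]; simp⟩
  · obtain ⟨x, hx⟩ := exists_lt_of_lt_ciSup (half_lt_self h)
    exact ⟨x, hx.le⟩

/-- If the remainder concentrates somewhere, it does so at points escaping from all centers used so
far, and the weak limit there competes with the profile chosen next. -/
theorem exists_tendsto_supAverage (𝒰 : Ultrafilter ℕ) {u : ℕ → D12 N} {M : ℝ}
    (hM : ∀ n, ‖gradMap N (u n)‖ ≤ M) {U : ℕ → D12 N} {y : ℕ → ℕ → Eucl N}
    (hy : ∀ i j, i ≠ j → Tendsto (fun n => ‖y i n - y j n‖) 𝒰 atTop)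
    (hU : ∀ i, WeakTo 𝒰 (fun n => D12.shift (y i n) (u n)) (U i)) {m : ℕ} {E : ℝ} (hE : 0 ≤ E)
    (hmax : ∀ (z : ℕ → Eucl N) (W : D12 N),
      (∀ j < m, Tendsto (fun n => ‖z n - y j n‖) 𝒰 atTop) →
      WeakTo 𝒰 (fun n => D12.shift (z n) (u n)) W → ‖gradMap N W‖ ≤ E)
    {k : ℕ} {C : ℝ} (hC0 : 0 ≤ C) (hC : ∀ v : D12 N, |average k v| ≤ C * ‖gradMap N v‖) :
    ∃ S, Tendsto (fun n => supAverage k (partialRemainder (u n) U (fun j => y j n) m)) 𝒰 (𝓝 S) ∧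
      S ≤ 2 * C * E := by
  set v : ℕ → D12 N := fun n => partialRemainder (u n) U (fun j => y j n) m
  set B := M + ∑ j ∈ Finset.range m, ‖gradMap N (U j)‖
  have hB : ∀ n, ‖gradMap N (v n)‖ ≤ B := fun n => norm_gradMap_partialRemainder_le _ _ _ _ (hM n)
  have hsB : ∀ n, |supAverage k (v n)| ≤ C * B := fun n => by
    rw [abs_of_nonneg (supAverage_nonneg _ _)]
    refine ciSup_le fun x => (hC _).trans ?_
    rw [norm_gradMap_shift]
    exact mul_le_mul_of_nonneg_left (hB n) hC0
  obtain ⟨S, hS⟩ := exists_tendsto_ultrafilter_of_abs_le 𝒰 hsB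
  refine ⟨S, hS, ?_⟩
  choose x hx using fun n => exists_supAverage_le k (v n)
  have hxB : ∀ (i : ℕ → Eucl N) n, ‖gradMap N (D12.shift (i n) (v n))‖ ≤ B := fun i n => by
    rw [norm_gradMap_shift]; exact hB n
  obtain ⟨W, hW⟩ := exists_weakTo_ultrafilter 𝒰 (hxB x)
  have hSW : S / 2 ≤ |average k W| :=
    le_of_tendsto_of_tendsto' (hS.div_const 2) (hW.functional (average k) hC).abs hx
  by_cases hesc : ∀ j < m, Tendsto (fun n => ‖x n - y j n‖) 𝒰 atTop
  · obtain ⟨W', hW'⟩ := exists_weakTo_ultrafilter 𝒰 (u := fun n => D12.shift (x n) (u n))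
      (fun n => by rw [norm_gradMap_shift]; exact hM n)
    have hWW : W = W' := hW.unique (hW'.shift_partialRemainder hesc)
    have h1 := hmax x W' hesc hW'
    have h2 := hC W
    have h3 : C * ‖gradMap N W‖ ≤ C * E := by
      rw [hWW]; exact mul_le_mul_of_nonneg_left h1 hC0
    linarith
  · -- near a removed profile the remainder vanishes weakly
    push Not at hesc
    obtain ⟨j, hj, hnot⟩ := hesc
    obtain ⟨z₀, hz₀⟩ := (tendsto_norm_atTop_or_exists_tendsto 𝒰 fun n => x n - y j n).resolve_left
      hnot
    have h0 := (weakTo_shift_partialRemainder_zero hy hU hj).shift_convergent (hxB (y j)) hz₀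
    simp only [shift_shift, sub_add_cancel] at h0
    have hW0 : W = 0 := hW.unique h0
    rw [hW0, map_zero, abs_zero] at hSW
    have : 0 ≤ 2 * C * E := by positivity
    linarith

/-- The decomposition along an ultrafilter: each new center is chosen, among the sequences escaping
from the previous ones, so that the gradient norm of its profile is at least half of the
largest possible. -/
theorem exists_profiles_ultrafilter (𝒰 : Ultrafilter ℕ) (h𝒰 : (𝒰 : Filter ℕ) ≤ atTop)
    {u : ℕ → D12 N} {M : ℝ} (hM : ∀ n, ‖gradMap N (u n)‖ ≤ M) :
    ∃ (U : ℕ → D12 N) (y : ℕ → ℕ → Eucl N),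
      y 0 = 0 ∧
      (∀ i j, i ≠ j → Tendsto (fun n => ‖y i n - y j n‖) 𝒰 atTop) ∧
      (∀ i, WeakTo 𝒰 (fun n => D12.shift (y i n) (u n)) (U i)) ∧
      ∀ k, ∃ C : ℝ, ∀ i, ∃ S : ℝ,
        Tendsto (fun n => supAverage k (remainder (u n) U (fun j => y j n) i)) 𝒰 (𝓝 S) ∧
          S ≤ C * ‖gradMap N (U (i + 1))‖ := by
  have hsM : ∀ (z : ℕ → Eucl N) n, ‖gradMap N (D12.shift (z n) (u n))‖ ≤ M := fun z n => by
    rw [norm_gradMap_shift]; exact hM n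
  choose P hP using fun z : ℕ → Eucl N => exists_weakTo_ultrafilter 𝒰 (hsM z)
  obtain ⟨y, hy0, hy⟩ := exists_greedy_seq
    (fun y z : ℕ → Eucl N => Tendsto (fun n => ‖y n - z n‖) 𝒰 atTop)
    (fun z => ‖gradMap N (P z)‖) 0 (fun s hs =>
      exists_forall_le_two_mul (exists_escaping _ h𝒰 hs) (fun z => norm_nonneg _)
        (fun z => (hP z).norm_le (hsM z)))
  have hlt : ∀ i j, j < i → Tendsto (fun n => ‖y i n - y j n‖) 𝒰 atTop := by
    rintro (_ | i) j hj
    · omega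
    · exact (hy i).1 j (by omega)
  have hne : ∀ i j, i ≠ j → Tendsto (fun n => ‖y i n - y j n‖) 𝒰 atTop := by
    intro i j hij
    rcases lt_or_gt_of_ne hij with h | h
    · simpa only [norm_sub_rev] using hlt j i h
    · exact hlt i j h
  refine ⟨fun i => P (y i), y, hy0, hne, fun i => hP (y i), fun k => ?_⟩
  obtain ⟨C, hC0, hC⟩ := exists_average_le N k
  refine ⟨4 * C, fun i => ?_⟩
  obtain ⟨S, hS, hle⟩ := exists_tendsto_supAverage 𝒰 hM hne (fun i => hP (y i)) (m := i + 1)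
    (E := 2 * ‖gradMap N (P (y (i + 1)))‖) (by positivity) (fun z W hz hW => by
      rw [hW.unique (hP z)]
      exact (hy i).2 z fun j hj => hz j (by omega)) hC0 hC
  exact ⟨S, hS, by linarith⟩

end Selection

/-! ### Extraction of a subsequence -/

/-- Countably many convergences along an ultrafilter hold simultaneously along a subsequence. -/
theorem exists_strictMono_tendsto {l : Filter ℕ} [NeBot l] (hl : l ≤ atTop) {κ α : Type*}
    [Countable κ] {f : κ → ℕ → α} {L : κ → Filter α} (hL : ∀ q, (L q).IsCountablyGenerated)
    (h : ∀ q, Tendsto (f q) l (L q)) :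
    ∃ σ : ℕ → ℕ, StrictMono σ ∧ ∀ q, Tendsto (fun n => f q (σ n)) atTop (L q) := by
  have hle : l ≤ (⨅ q, comap (f q) (L q)) ⊓ map id atTop :=
    le_inf (le_iInf fun q => map_le_iff_le_comap.1 (h q)) (by rwa [map_id])
  obtain ⟨σ, hσ, ht⟩ := subseq_tendsto_of_neBot (neBot_of_le hle)
  refine ⟨σ, hσ, fun q => ?_⟩
  have := tendsto_iInf.1 ht q
  exact tendsto_comap_iff.1 this

section Extraction

variable {N : ℕ} [hN : Fact (3 ≤ N)]

/-- The decomposition along a subsequence. Weak convergence is encoded by countably many test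
fields, dense in `L^2`. -/
theorem exists_profiles {u : ℕ → D12 N} {M : ℝ} (hM : ∀ n, ‖gradMap N (u n)‖ ≤ M) :
    ∃ (U : ℕ → D12 N) (y : ℕ → ℕ → Eucl N) (σ : ℕ → ℕ), StrictMono σ ∧
      (∀ n, y 0 n = 0) ∧
      (∀ i j, i ≠ j → Tendsto (fun n => ‖y i n - y j n‖) atTop atTop) ∧
      (∀ i, WeakTo atTop (fun n => D12.shift (y i n) (u (σ n))) (U i)) ∧
      (∃ L, Tendsto (fun n => D12.energy (u (σ n))) atTop (𝓝 L)) ∧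
      ∀ k, ∃ C : ℝ, ∀ i, ∃ S : ℝ,
        Tendsto (fun n => supAverage k (remainder (u (σ n)) U (fun j => y j n) i)) atTop (𝓝 S) ∧
          S ≤ C * ‖gradMap N (U (i + 1))‖ := by
  have h𝒰 : (hyperfilter ℕ : Filter ℕ) ≤ atTop := Nat.hyperfilter_le_atTop
  obtain ⟨U, y, hy0, hy, hU, hS⟩ := exists_profiles_ultrafilter (hyperfilter ℕ) h𝒰 hM
  obtain ⟨L, hL⟩ := exists_tendsto_ultrafilter_of_abs_le (hyperfilter ℕ)
    (a := fun n => D12.energy (u n)) (M := M ^ 2) (fun n => by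
      rw [energy_eq_norm_sq, abs_of_nonneg (by positivity)]
      have := hM n
      gcongr)
  choose C S hS hSC using hS
  have : Fact ((2 : ℝ≥0∞) ≠ ⊤) := ⟨ENNReal.ofNat_ne_top⟩
  let d := TopologicalSpace.denseSeq (Lp (Eucl N) 2 (volume : Measure (Eucl N)))
  obtain ⟨σ, hσ, ht⟩ := exists_strictMono_tendsto
    (κ := (ℕ × ℕ) ⊕ {q : ℕ × ℕ // q.1 ≠ q.2} ⊕ Unit ⊕ (ℕ × ℕ)) (α := ℝ) h𝒰
    (f := Sum.elim (fun q n => inner ℝ (d q.2) (gradMap N (D12.shift (y q.1 n) (u n))))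
      (Sum.elim (fun q n => ‖y q.1.1 n - y q.1.2 n‖) (Sum.elim (fun _ n => D12.energy (u n))
        (fun q n => supAverage q.2 (remainder (u n) U (fun j => y j n) q.1)))))
    (L := Sum.elim (fun q => 𝓝 (inner ℝ (d q.2) (gradMap N (U q.1))))
      (Sum.elim (fun _ => atTop) (Sum.elim (fun _ => 𝓝 L) (fun q => 𝓝 (S q.2 q.1)))))
    (by rintro (q | q | q | q) <;> simp only [Sum.elim_inl, Sum.elim_inr] <;> infer_instance)
    (by
      rintro (q | q | q | q)
      · exact hU q.1 (d q.2)
      · exact hy _ _ q.2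
      · exact hL
      · exact hS q.2 q.1)
  refine ⟨U, fun i n => y i (σ n), σ, hσ, fun n => congrFun hy0 (σ n),
    fun i j hij => ht (Sum.inr (Sum.inl ⟨(i, j), hij⟩)), fun i => ?_,
    ⟨L, ht (Sum.inr (Sum.inr (Sum.inl ())))⟩,
    fun k => ⟨C k, fun i => ⟨S k i, ht (Sum.inr (Sum.inr (Sum.inr (i, k)))), hSC k i⟩⟩⟩
  exact WeakTo.of_denseRange (TopologicalSpace.denseRange_denseSeq _)
    (fun n => by rw [norm_gradMap_shift]; exact hM _) fun k => ht (Sum.inl (i, k))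

end Extraction

/-! ### Energies and nonlinear integrals of the remainders -/

theorem limsup_coe_eq_of_tendsto_sub {x z : ℕ → ℝ} {c : ℝ}
    (h : Tendsto (fun n => x n - z n) atTop (𝓝 c)) :
    limsup (fun n => (x n : EReal)) atTop =
      (c : EReal) + limsup (fun n => (z n : EReal)) atTop := by
  have hd : Tendsto (fun n => ((x n - z n : ℝ) : EReal)) atTop (𝓝 (c : EReal)) :=
    (continuous_coe_real_ereal.tendsto c).comp h
  have hx : (fun n => (x n : EReal)) =
      (fun n => (z n : EReal)) + fun n => ((x n - z n : ℝ) : EReal) := by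
    ext n
    rw [Pi.add_apply, ← EReal.coe_add, add_sub_cancel]
  rw [hx, add_comm (c : EReal)]
  refine le_antisymm ?_ ?_
  · refine (EReal.limsup_add_le ?_ ?_).trans (le_of_eq (by rw [hd.limsup_eq]))
    · exact Or.inr (by rw [hd.limsup_eq]; exact EReal.coe_ne_top c)
    · exact Or.inr (by rw [hd.limsup_eq]; exact EReal.coe_ne_bot c)
  · refine le_trans (le_of_eq ?_) EReal.le_limsup_add
    rw [hd.liminf_eq]

section Splitting

variable {N : ℕ} [hN : Fact (3 ≤ N)] {u U : ℕ → D12 N} {y : ℕ → ℕ → Eucl N}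

theorem tendsto_energy_partialRemainder
    (hy : ∀ i j, i ≠ j → Tendsto (fun n => ‖y i n - y j n‖) atTop atTop)
    (hU : ∀ i, WeakTo atTop (fun n => D12.shift (y i n) (u n)) (U i)) {L : ℝ}
    (hL : Tendsto (fun n => D12.energy (u n)) atTop (𝓝 L)) (m : ℕ) :
    Tendsto (fun n => D12.energy (partialRemainder (u n) U (fun j => y j n) m)) atTop
      (𝓝 (L - ∑ j ∈ Finset.range m, D12.energy (U j))) := by
  induction m with
  | zero => simpa only [partialRemainder_zero, Finset.range_zero, Finset.sum_empty, sub_zero]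
  | succ m ih =>
    have h := ((hU m).shift_partialRemainder (U := U) (y := y) (m := m)
      fun j hj => hy m j hj.ne').tendsto_energy_sub
    have h' := ih.sub h
    rw [Finset.sum_range_succ, ← sub_sub]
    refine h'.congr fun n => ?_
    rw [← shift_partialRemainder_succ (u n) U (fun j => y j n) m, energy_shift, energy_shift]
    ring

theorem HasGrowth.tendsto_nonlinInt_sub_partialRemainder {Ψ : ℝ → ℝ} {C : ℝ}
    (h : HasGrowth Ψ (critExp N) C) {M : ℝ} (hM : ∀ n, ‖gradMap N (u n)‖ ≤ M)
    (hy : ∀ i j, i ≠ j → Tendsto (fun n => ‖y i n - y j n‖) atTop atTop)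
    (hU : ∀ i, WeakTo atTop (fun n => D12.shift (y i n) (u n)) (U i)) (m : ℕ) :
    Tendsto (fun n => nonlinInt Ψ (u n) -
        nonlinInt Ψ (partialRemainder (u n) U (fun j => y j n) m)) atTop
      (𝓝 (∑ j ∈ Finset.range m, nonlinInt Ψ (U j))) := by
  induction m with
  | zero => simp [partialRemainder_zero]
  | succ m ih =>
    have h' := ih.add (h.tendsto_nonlinInt_sub ((hU m).shift_partialRemainder (U := U) (y := y)
      (m := m) fun j hj => hy m j hj.ne') fun n => by
        rw [norm_gradMap_shift]
        exact norm_gradMap_partialRemainder_le _ _ _ _ (hM n))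
    rw [Finset.sum_range_succ]
    refine h'.congr fun n => ?_
    rw [← shift_partialRemainder_succ (u n) U (fun j => y j n) m, nonlinInt_shift, nonlinInt_shift]
    ring

/-- The profiles have finite total energy, so each new profile, and with it all averages of the
remainder, becomes small; Lions' vanishing principle applies. -/
theorem HasGrowth.tendsto_limsup_nonlinInt_remainder {Ψ : ℝ → ℝ} {C : ℝ}
    (h : HasGrowth Ψ (critExp N) C) (hs : SubcriticalAtZeroAndInfinity N Ψ)
    (hy : ∀ i j, i ≠ j → Tendsto (fun n => ‖y i n - y j n‖) atTop atTop)
    (hU : ∀ i, WeakTo atTop (fun n => D12.shift (y i n) (u n)) (U i)) {L : ℝ}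
    (hL : Tendsto (fun n => D12.energy (u n)) atTop (𝓝 L))
    (hS : ∀ k, ∃ C : ℝ, ∀ i, ∃ S : ℝ,
      Tendsto (fun n => supAverage k (remainder (u n) U (fun j => y j n) i)) atTop (𝓝 S) ∧
        S ≤ C * ‖gradMap N (U (i + 1))‖) :
    Tendsto (fun i => limsup (fun n =>
      (nonlinInt Ψ (remainder (u n) U (fun j => y j n) i) : EReal)) atTop) atTop (𝓝 0) := by
  have hE := tendsto_energy_partialRemainder hy hU hL
  have hE0 : ∀ v : D12 N, 0 ≤ D12.energy v := fun v => by rw [energy_eq_norm_sq]; positivity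
  have hsum : ∀ m, ∑ j ∈ Finset.range m, D12.energy (U j) ≤ L := fun m =>
    sub_nonneg.1 (ge_of_tendsto' (hE m) fun n => hE0 _)
  have hU0 : Tendsto (fun i => ‖gradMap N (U (i + 1))‖) atTop (𝓝 0) := by
    have h1 := (summable_of_sum_range_le (fun j => hE0 (U j)) hsum).tendsto_atTop_zero
    have h2 := ((tendsto_add_atTop_iff_nat 1).2 h1).sqrt
    rw [Real.sqrt_zero] at h2
    refine h2.congr fun i => ?_
    rw [energy_eq_norm_sq, Real.sqrt_sq (norm_nonneg _)]
  have main : ∀ ε : ℝ, 0 < ε → ∀ᶠ i in atTop, ∀ᶠ n in atTop,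
      |nonlinInt Ψ (remainder (u n) U (fun j => y j n) i)| ≤ ε := by
    intro ε hε
    obtain ⟨k, a, ha, hk⟩ := h.exists_abs_nonlinInt_le hs (L + 1) hε
    obtain ⟨C, hC⟩ := hS k
    have hCU : Tendsto (fun i => C * ‖gradMap N (U (i + 1))‖) atTop (𝓝 0) := by
      simpa using hU0.const_mul C
    filter_upwards [hCU.eventually_lt_const ha] with i hi
    obtain ⟨S, hS, hle⟩ := hC i
    have hLi : L - ∑ j ∈ Finset.range (i + 1), D12.energy (U j) < L + 1 := by
      have := Finset.sum_nonneg fun j (_ : j ∈ Finset.range (i + 1)) => hE0 (U j)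
      linarith
    filter_upwards [hS.eventually_lt_const (hle.trans_lt hi),
      (hE (i + 1)).eventually_lt_const hLi] with n hn hn'
    exact hk _ hn'.le fun x => (abs_average_shift_le_supAverage k _ x).trans_lt hn
  refine tendsto_order.2 ⟨fun b hb => ?_, fun b hb => ?_⟩
  · obtain ⟨ε, hbε, hε⟩ := EReal.lt_iff_exists_real_btwn.1 hb
    have hε' : 0 < -ε := by
      have : ε < 0 := by exact_mod_cast hε
      linarith
    filter_upwards [main (-ε) hε'] with i hi
    refine hbε.trans_le (le_trans (le_liminf_of_le (by isBoundedDefault) ?_) liminf_le_limsup)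
    filter_upwards [hi] with n hn
    exact EReal.coe_le_coe_iff.2 (by linarith [(abs_le.1 hn).1])
  · obtain ⟨ε, hε, hεb⟩ := EReal.lt_iff_exists_real_btwn.1 hb
    filter_upwards [main ε (by exact_mod_cast hε)] with i hi
    refine (limsup_le_of_le (by isBoundedDefault) ?_).trans_lt hεb
    filter_upwards [hi] with n hn
    exact EReal.coe_le_coe_iff.2 (abs_le.1 hn).2

end Splitting

end ProfileDecomposition

end

theorem theoremA3 (N : ℕ) [Fact (3 ≤ N)] (u : ℕ → D12 N)
    (hu : ∃ M : ℝ, ∀ n, D12.gradNorm (u n) ≤ M) :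
    -- `y i n` is the translation `y_n^i` along the subsequence `u (σ n)`
    ∃ (U : ℕ → D12 N) (y : ℕ → ℕ → Eucl N) (σ : ℕ → ℕ), StrictMono σ ∧
      (∀ n, y 0 n = 0) ∧
      (∀ i j, i ≠ j → Tendsto (fun n => ‖y i n - y j n‖) atTop atTop) ∧
      (∀ i, D12.WeaklyTendsto (fun n => D12.shift (y i n) (u (σ n))) (U i)) ∧
      (∃ (L : ℝ) (l : ℕ → ℝ),
        Tendsto (fun n => D12.energy (u (σ n))) atTop (𝓝 L) ∧
        ∀ i,
          Tendsto (fun n => D12.energy (remainder (u (σ n)) U (fun j => y j n) i))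
            atTop (𝓝 (l i)) ∧
          L = ∑ j ∈ Finset.range (i + 1), D12.energy (U j) + l i) ∧
      ∀ Ψ : ℝ → ℝ, ContDiff ℝ 1 Ψ → Ψ 0 = 0 →
        (∃ C : ℝ, ∀ s : ℝ, |deriv Ψ s| ≤ C * |s| ^ (critExp N - 1)) →
        (∀ w : D12 N, Integrable (fun x => Ψ (D12.toFun w x)) volume) ∧
        (∀ i, limsup (fun n => (nonlinInt Ψ (u (σ n)) : EReal)) atTop =
          ((∑ j ∈ Finset.range (i + 1), nonlinInt Ψ (U j) : ℝ) : EReal) +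
            limsup (fun n =>
              (nonlinInt Ψ (remainder (u (σ n)) U (fun j => y j n) i) : EReal)) atTop) ∧
        (SubcriticalAtZeroAndInfinity N Ψ →
          Tendsto (fun i => limsup (fun n =>
              (nonlinInt Ψ (remainder (u (σ n)) U (fun j => y j n) i) : EReal)) atTop)
            atTop (𝓝 0)) := by
  obtain ⟨M, hM⟩ := hu
  simp only [gradNorm_eq_norm] at hM
  obtain ⟨U, y, σ, hσ, hy0, hy, hU, ⟨L, hL⟩, hS⟩ := exists_profiles hM
  refine ⟨U, y, σ, hσ, hy0, hy, fun i => (hU i).weaklyTendsto,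
    ⟨L, fun i => L - ∑ j ∈ Finset.range (i + 1), D12.energy (U j), hL, fun i =>
      ⟨tendsto_energy_partialRemainder hy hU hL (i + 1), by ring⟩⟩, ?_⟩
  rintro Ψ hΨ hΨ0 ⟨C, hC⟩
  have h : HasGrowth Ψ (critExp N) C :=
    ⟨critExp_gt_one N, hΨ.differentiable one_ne_zero, hΨ0, hC⟩
  exact ⟨h.integrable_toFun, fun i => limsup_coe_eq_of_tendsto_sub
      (h.tendsto_nonlinInt_sub_partialRemainder (fun n => hM (σ n)) hy hU (i + 1)),
    fun hs => h.tendsto_limsup_nonlinInt_remainder hs hy hU hL hS⟩
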